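/- Let $c\in\{0,1,2,\dots\}$, $m\in\mathbb Z$ and $\alpha\ge 1$. For real $\nu$ put $\phi_{\nu,0}(x)=e^{-\nu x}$ and $\phi_{\nu,c}(x)=(1+cx)^{-\nu/c}$ if $c\ge1$, and, for $x\ge0$ and $k=0,1,2,\dots$, $$p_{\nu,k}(x;c)=\frac{(-x)^k}{k!}\phi_{\nu,c}^{(k)}(x),\qquad J_{\nu,k}(x,c)=\sum_{j=k}^\infty p_{\nu,j}(x;c),\qquad Q^{(\alpha)}_{\nu,k}(x;c)=J_{\nu,k}(x,c)^\alpha-J_{\nu,k+1}(x,c)^\alpha .$$ The Bézier variant of the Gupta–Srivastava operators is $$F_{n,m}^{c,\alpha}(f;x)=\{n+(m+1)c\}\sum_{k=1}^\infty Q^{(\alpha)}_{n+mc,k}(x;c)\int_0^\infty p_{n+(m+2)c,k-1}(t;c)f(t)\,dt+Q^{(\alpha)}_{n+mc,0}(x;c)f(0).$$ Let $f\in DBV[0,\infty)$, that is, $f:[0,\infty)\to\mathbb R$ is absolutely continuous on every interval $[0,b]$ and its derivative coincides a.e. with a function, denoted $f'$ below, which is of bounded variation on every finite subinterval of $[0,\infty)$.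 For $x>0$ let $$f'_x(t)=\begin{cases}f'(t)-f'(x-),&0\le t<x,\\0,&t=x,\\f'(t)-f'(x+),&t>x,\end{cases}$$ and let $V_a^b h$ be the total variation of $h$ on $[a,b]$. Then $F_{n,m}^{c,\alpha}(f;0)=f(0)$ for every $n$. Moreover, let $x>0$ and let $M,\gamma,r$ be real numbers with $0\le\gamma\le 2r$, $r>0$ and $|f(t)|\le Mt^\gamma$ for all $t\ge 2x$. Then for all sufficiently large $n$ the integrals and series that define $F_{n,m}^{c,\alpha}(f;x)$ and $F_{n,m}^{c,\alpha}(\psi;x)$ below converge, and \begin{align*} \left|F_{n,m}^{c,\alpha}(f;x)-f(x)\right|\le{}&\frac1{\alpha+1}\left|f'(x+)+\alpha f'(x-)\right|\sqrt{\frac{2\alpha x(1+cx)}n}+\frac{\alpha}{\alpha+1}\left|f'(x+)-f'(x-)\right|\sqrt{\frac{2\alpha x(1+cx)}n}\\ &+\frac{2\alpha(1+cx)}n\sum_{k=1}^{[\sqrt n]}V_{x-x/k}^{x}f'_x+\frac{x}{\sqrt n}V_{x-x/\sqrt n}^{x}f'_x\\ &+\frac{2\alpha(1+cx)}{nx}\left|f(2x)-f(x)-xf'(x+)\right|\\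 &+\frac{2\alpha(1+cx)}n\sum_{k=1}^{[\sqrt n]}V_{x}^{x+x/k}f'_x+\frac{x}{\sqrt n}V_{x}^{x+x/\sqrt n}f'_x\\ &+M(\gamma,r,x)+\frac{2\alpha(1+cx)}{nx}|f(x)|+\sqrt{\frac{2\alpha x(1+cx)}n}\,|f'(x+)| , \end{align*} where $M(\gamma,r,x)=M\,2^\gamma\left(F_{n,m}^{c,\alpha}(\psi;x)\right)^{\gamma/(2r)}$ with $\psi(t)=(t-x)^{2r}$ for $t>2x$ and $\psi(t)=0$ for $0\le t\le 2x$. -/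

import Mathlib

open Set Filter MeasureTheory

namespace GuptaSrivastava

noncomputable section

/-- The generating function `φ_{ν,c}`: `e^{-νx}` if `c = 0` and `(1 + cx)^{-ν/c}` if `c ≥ 1`. -/
def phi (ν : ℝ) (c : ℕ) (x : ℝ) : ℝ :=
  if c = 0 then Real.exp (-(ν * x)) else (1 + (c : ℝ) * x) ^ (-(ν / (c : ℝ)))

/-- The basis function `p_{ν,k}(x;c) = ((-x)^k / k!) φ_{ν,c}^{(k)}(x)`. -/
def basisFun (ν : ℝ) (c k : ℕ) (x : ℝ) : ℝ :=
  (-x) ^ k / (Nat.factorial k : ℝ) * iteratedDeriv k (phi ν c) x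

/-- `J_{ν,k}(x;c) = ∑_{j ≥ k} p_{ν,j}(x;c)`. -/
def tailSum (ν : ℝ) (c k : ℕ) (x : ℝ) : ℝ :=
  ∑' j : ℕ, basisFun ν c (k + j) x

/-- The Bézier weight `Q^{(α)}_{ν,k}(x;c) = J_{ν,k}(x;c)^α - J_{ν,k+1}(x;c)^α`. -/
def bezierWeight (ν : ℝ) (c : ℕ) (α : ℝ) (k : ℕ) (x : ℝ) : ℝ :=
  tailSum ν c k x ^ α - tailSum ν c (k + 1) x ^ α

/-- The `k`-th term (shifted to start at `k = 0`) of the series defining the operator: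
`Q^{(α)}_{n+mc,k+1}(x;c) ∫_0^∞ p_{n+(m+2)c,k}(t;c) f(t) dt`. -/
def bezierTerm (n : ℕ) (m : ℤ) (c : ℕ) (α : ℝ) (f : ℝ → ℝ) (x : ℝ) (k : ℕ) : ℝ :=
  bezierWeight ((n : ℝ) + (m : ℝ) * (c : ℝ)) c α (k + 1) x *
    ∫ t in Ioi (0 : ℝ), basisFun ((n : ℝ) + ((m : ℝ) + 2) * (c : ℝ)) c k t * f t

/-- The Bézier variant `F_{n,m}^{c,α}(f;x)` of the Gupta–Srivastava operator. -/
def bezierOp (n : ℕ) (m : ℤ) (c : ℕ) (α : ℝ) (f : ℝ → ℝ) (x : ℝ) : ℝ :=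
  ((n : ℝ) + ((m : ℝ) + 1) * (c : ℝ)) * ∑' k : ℕ, bezierTerm n m c α f x k
    + bezierWeight ((n : ℝ) + (m : ℝ) * (c : ℝ)) c α 0 x * f 0

/-- `F_{n,m}^{c,α}(f;x)` is well defined: the integrals and the series in it converge. -/
def BezierConverges (n : ℕ) (m : ℤ) (c : ℕ) (α : ℝ) (f : ℝ → ℝ) (x : ℝ) : Prop :=
  (∀ k : ℕ, IntegrableOn
    (fun t => basisFun ((n : ℝ) + ((m : ℝ) + 2) * (c : ℝ)) c k t * f t) (Ioi (0 : ℝ))) ∧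
  Summable (bezierTerm n m c α f x)

/-- `f ∈ DBV[0,∞)`, with derivative `g`: `f` is absolutely continuous on the compact subintervals
of `[0,∞)`, `g` is of bounded variation on these subintervals, and `f' = g` almost everywhere. -/
structure IsDBV (f g : ℝ → ℝ) : Prop where
  absolutelyContinuous : ∀ b : ℝ, 0 ≤ b → AbsolutelyContinuousOnInterval f 0 b
  boundedVariation : LocallyBoundedVariationOn g (Ici (0 : ℝ))
  hasDerivAt_ae : ∀ᵐ t ∂(volume.restrict (Ioi (0 : ℝ))), HasDerivAt f (g t) t

/-- The auxiliary function `h_x`: `h(t) - h(x-)` for `t < x`, `0` for `t = x` and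
`h(t) - h(x+)` for `t > x`. -/
def auxFun (h : ℝ → ℝ) (x t : ℝ) : ℝ :=
  if t < x then h t - Function.leftLim h x
  else if t = x then 0
  else h t - Function.rightLim h x

/-- The total variation of `h` on `[a,b]`. -/
def totalVar (h : ℝ → ℝ) (a b : ℝ) : ℝ := (eVariationOn h (Icc a b)).toReal

/-- The truncated power: `(t - x)^s` for `t > 2x`, and `0` for `t ≤ 2x`. -/
def truncPow (x s t : ℝ) : ℝ := (Ioi (2 * x)).indicator (fun u => (u - x) ^ s) t

end

end GuptaSrivastava

/-!
The operator is an expectation. With `ν = n + mc`, let `K` be a random index of law `p_{ν,k}(x)`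
(Poisson for `c = 0`, negative binomial for `c ≥ 1`), and given `K = k` let `T` be `0` if `k = 0`
and of density `(ν + c) p_{ν+2c,k-1}` on `(0,∞)` otherwise. The law of `T` is `baseLaw`. With the
Bézier weights in place of `p_{ν,k}(x)` one gets `bezierLaw`, again a probability, against which
integration is the operator (`bezierOp_eq_integral`); it is at most `α` times the base law
(`bezierLaw_le`), as `t ↦ t ^ α` is `α`-Lipschitz on `[0,1]`.

The representation `p_{ν,k}(x) = ν (ν + c) ⋯ (ν + (k - 1) c) / k! · (x / (1 + c x)) ^ k φ_{ν,c}(x)`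
holds for all `c ≥ 0` and makes the moments of the base law explicit: the mean is `x`, the variance
`2x(1 + cx) / (n + (m - 1) c)`, the fourth central moment `O(n⁻²)`.

The function is affine on either side of `x`, with slopes `f'(x-)` and `f'(x+)`, up to a primitive
of the variation of `f'_x` (`IsDBV.abs_sub_le`). The mean of this primitive is, by the layer cake
formula, an integral of tail probabilities against the variation (`integral_primitive_le`); with
`P(|T - x| ≥ s) = O(1 / (n s²))` it becomes the sum over `k ≤ √n`. Beyond `2x` the growth bound
and Jensen's inequality give the term in `ψ`. The two affine parts contribute at most
`(|f'(x-)| + |f'(x+)|) √(2αx(1 + cx)/n)`, which the terms with one-sided derivatives dominate by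
the triangle inequality.

When `c ≥ 1` and `m ≤ 0` the variance exceeds `2x(1 + cx)/n`, and the plain inequalities of
Chebyshev and Cauchy–Schwarz miss the stated constants by a factor `1 + O(1/n)`. They are replaced
by sharper ones. For the tails, Cantelli's inequality gains a factor `1 + σ² / a²`, enough for
bounded `a`, and the fourth moment handles the other `a` (`meas_ge_le_of_moments`). For the mean
deviations, only one of the two sides of `x` is concerned at a time, and the other side carries a
fixed share of the variance, by a lower bound through the fourth moment (`integral_posPart_le`).
-/

namespace GuptaSrivastava

/-! ### The basis functions -/

/-- The product `ν (ν + c) ⋯ (ν + (k - 1) c)`. -/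
noncomputable def stepProd (ν : ℝ) (c k : ℕ) : ℝ := ∏ i ∈ Finset.range k, (ν + i * c)

lemma stepProd_succ (ν : ℝ) (c k : ℕ) :
    stepProd ν c (k + 1) = stepProd ν c k * (ν + k * c) := Finset.prod_range_succ _ _

lemma stepProd_succ' (ν : ℝ) (c k : ℕ) :
    stepProd ν c (k + 1) = ν * stepProd (ν + c) c k := by
  unfold stepProd
  rw [Finset.prod_range_succ', mul_comm]
  congr 1
  · simp
  · refine Finset.prod_congr rfl fun i _ => ?_
    push_cast; ring

lemma stepProd_add (ν : ℝ) (c j k : ℕ) :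
    stepProd ν c (j + k) = stepProd ν c j * stepProd (ν + j * c) c k := by
  unfold stepProd
  rw [Finset.prod_range_add]
  congr 1
  refine Finset.prod_congr rfl fun i _ => ?_
  push_cast; ring

lemma stepProd_nonneg {ν : ℝ} (hν : 0 ≤ ν) (c k : ℕ) : 0 ≤ stepProd ν c k :=
  Finset.prod_nonneg fun i _ => by positivity

lemma stepProd_pos {ν : ℝ} (hν : 0 < ν) (c k : ℕ) : 0 < stepProd ν c k :=
  Finset.prod_pos fun i _ => by positivity

lemma phi_pos (ν : ℝ) (c : ℕ) {x : ℝ} (hx : 0 < 1 + c * x) : 0 < phi ν c x := by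
  unfold phi
  split_ifs
  · positivity
  · exact Real.rpow_pos_of_pos hx _

lemma phi_zero_right (ν : ℝ) (c : ℕ) : phi ν c 0 = 1 := by simp [phi]

lemma phi_add_mul (ν : ℝ) (c k : ℕ) {x : ℝ} (hx : 0 < 1 + c * x) :
    phi (ν + k * c) c x = phi ν c x / (1 + c * x) ^ k := by
  unfold phi
  split_ifs with h
  · simp [h]
  · have hc : (c : ℝ) ≠ 0 := by exact_mod_cast h
    rw [← Real.rpow_natCast, ← Real.rpow_sub hx]
    congr 1
    field_simp
    ring

lemma hasDerivAt_phi (ν : ℝ) (c : ℕ) {x : ℝ} (hx : 0 < 1 + c * x) :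
    HasDerivAt (phi ν c) (-ν * phi (ν + c) c x) x := by
  have h1 := phi_add_mul ν c 1 hx
  simp only [Nat.cast_one, one_mul, pow_one] at h1
  rw [h1]
  unfold phi
  split_ifs with h
  · have : HasDerivAt (fun y : ℝ => -(ν * y)) (-(ν * 1)) x := ((hasDerivAt_id x).const_mul ν).neg
    convert! this.exp using 1
    simp [h]; ring
  · have hc : (c : ℝ) ≠ 0 := by exact_mod_cast h
    have : HasDerivAt (fun y : ℝ => 1 + (c : ℝ) * y) ((c : ℝ) * 1) x :=
      ((hasDerivAt_id x).const_mul (c : ℝ)).const_add 1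
    convert! this.rpow_const (p := -(ν / c)) (Or.inl hx.ne') using 1
    rw [Real.rpow_sub hx, Real.rpow_one]
    field_simp

lemma eventually_domain (c : ℕ) {x : ℝ} (hx : 0 < 1 + c * x) :
    ∀ᶠ y in nhds x, 0 < 1 + (c : ℝ) * y :=
  (isOpen_lt (by fun_prop) (by fun_prop)).mem_nhds hx

lemma iteratedDeriv_phi (ν : ℝ) (c k : ℕ) {x : ℝ} (hx : 0 < 1 + c * x) :
    iteratedDeriv k (phi ν c) x = (-1) ^ k * stepProd ν c k * phi (ν + k * c) c x := by
  induction k generalizing x with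
  | zero => simp [stepProd]
  | succ k ih =>
    rw [iteratedDeriv_succ]
    have h : iteratedDeriv k (phi ν c) =ᶠ[nhds x]
        fun y => (-1) ^ k * stepProd ν c k * phi (ν + k * c) c y := by
      filter_upwards [eventually_domain c hx] with y hy using ih hy
    rw [h.deriv_eq, ((hasDerivAt_phi (ν + k * c) c hx).const_mul _).deriv, stepProd_succ]
    push_cast
    rw [show ν + k * c + c = ν + (k + 1) * c by ring]
    ring

/-- The basis functions without derivatives, in the variable `x / (1 + c x)`. -/
lemma basisFun_eq (ν : ℝ) (c k : ℕ) {x : ℝ} (hx : 0 < 1 + c * x) :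
    basisFun ν c k x =
      stepProd ν c k / k.factorial * (x / (1 + c * x)) ^ k * phi ν c x := by
  rw [basisFun, iteratedDeriv_phi ν c k hx, phi_add_mul ν c k hx, div_pow, neg_pow]
  have : ((-1 : ℝ) ^ k) * (-1) ^ k = 1 := by rw [← mul_pow]; simp
  linear_combination (x ^ k / (k.factorial : ℝ) * (stepProd ν c k *
    (phi ν c x / (1 + c * x) ^ k))) * this

lemma basisFun_eq' (ν : ℝ) (c k : ℕ) {x : ℝ} (hx : 0 < 1 + c * x) :
    basisFun ν c k x =
      stepProd ν c k / k.factorial * (x ^ k * phi (ν + k * c) c x) := by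
  rw [basisFun_eq ν c k hx, phi_add_mul ν c k hx, div_pow]
  ring

lemma domain_of_nonneg (c : ℕ) {x : ℝ} (hx : 0 ≤ x) : 0 < 1 + (c : ℝ) * x := by positivity

lemma basisFun_nonneg {ν : ℝ} (hν : 0 ≤ ν) (c k : ℕ) {x : ℝ} (hx : 0 ≤ x) :
    0 ≤ basisFun ν c k x := by
  have h := domain_of_nonneg c hx
  have := phi_pos ν c h
  have := stepProd_nonneg hν c k
  rw [basisFun_eq ν c k h]
  positivity

lemma basisFun_zero_right (ν : ℝ) (c k : ℕ) : basisFun ν c k 0 = if k = 0 then 1 else 0 := by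
  rw [basisFun_eq' ν c k (by simp)]
  split_ifs with h
  · subst h; simp [stepProd, phi_zero_right]
  · simp [h]

lemma hasDerivAt_basisFun_zero (ν : ℝ) (c : ℕ) {x : ℝ} (hx : 0 < 1 + c * x) :
    HasDerivAt (basisFun ν c 0) (-ν * basisFun (ν + c) c 0 x) x := by
  have h : basisFun ν c 0 =ᶠ[nhds x] phi ν c := by
    filter_upwards [eventually_domain c hx] with y hy
    rw [basisFun_eq ν c 0 hy]; simp [stepProd]
  refine ((hasDerivAt_phi ν c hx).congr_of_eventuallyEq h).congr_deriv ?_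
  rw [basisFun_eq _ c 0 hx]; simp [stepProd]

lemma hasDerivAt_basisFun_succ (ν : ℝ) (c k : ℕ) {x : ℝ} (hx : 0 < 1 + c * x) :
    HasDerivAt (basisFun ν c (k + 1))
      (ν * (basisFun (ν + c) c k x - basisFun (ν + c) c (k + 1) x)) x := by
  have h : basisFun ν c (k + 1) =ᶠ[nhds x] fun y => stepProd ν c (k + 1) / (k + 1).factorial *
      (y ^ (k + 1) * phi (ν + (k + 1 : ℕ) * c) c y) := by
    filter_upwards [eventually_domain c hx] with y hy using basisFun_eq' ν c (k + 1) hy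
  have hd := (((hasDerivAt_pow (k + 1) x).mul
    (hasDerivAt_phi (ν + (k + 1 : ℕ) * c) c hx)).const_mul
      (stepProd ν c (k + 1) / (k + 1).factorial)).congr_of_eventuallyEq h
  refine hd.congr_deriv ?_
  rw [basisFun_eq' (ν + c) c k hx, basisFun_eq' (ν + c) c (k + 1) hx]
  have e1 := stepProd_succ' ν c k
  have e2 := stepProd_succ (ν + c) c k
  have e3 : (ν + c + k * c) = ν + (k + 1 : ℕ) * c := by push_cast; ring
  have e4 : (ν + c + (k + 1 : ℕ) * c) = ν + (k + 1 : ℕ) * c + c := by ring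
  rw [e4, e2, e3, e1, Nat.factorial_succ]
  have : (k.factorial : ℝ) ≠ 0 := by positivity
  push_cast
  field_simp
  ring

/-- The partial sums of the basis telescope under differentiation. -/
lemma hasDerivAt_sum_basisFun (ν : ℝ) (c k : ℕ) {x : ℝ} (hx : 0 < 1 + c * x) :
    HasDerivAt (fun y => ∑ j ∈ Finset.range (k + 1), basisFun ν c j y)
      (-ν * basisFun (ν + c) c k x) x := by
  induction k with
  | zero => simpa using hasDerivAt_basisFun_zero ν c hx
  | succ k ih =>
    simp_rw [Finset.sum_range_succ _ (k + 1)]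
    refine (ih.add (hasDerivAt_basisFun_succ ν c k hx)).congr_deriv ?_
    ring

lemma continuousOn_basisFun (ν : ℝ) (c k : ℕ) : ContinuousOn (basisFun ν c k) (Ici 0) := by
  intro x hx
  have h := domain_of_nonneg c (mem_Ici.1 hx)
  cases k with
  | zero => exact (hasDerivAt_basisFun_zero ν c h).continuousAt.continuousWithinAt
  | succ k => exact (hasDerivAt_basisFun_succ ν c k h).continuousAt.continuousWithinAt

lemma tendsto_basisFun_atTop {ν : ℝ} (hν : 0 < ν) (c k : ℕ) :
    Tendsto (basisFun ν c k) atTop (nhds 0) := by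
  rcases Nat.eq_zero_or_pos c with rfl | hc
  · have h1 : Tendsto (fun x : ℝ => (ν * x) ^ k * Real.exp (-(ν * x))) atTop (nhds 0) :=
      (Real.tendsto_pow_mul_exp_neg_atTop_nhds_zero k).comp (tendsto_id.const_mul_atTop hν)
    have h2 := h1.const_mul (stepProd ν 0 k / k.factorial / ν ^ k)
    rw [mul_zero] at h2
    refine h2.congr fun x => ?_
    rw [basisFun_eq ν 0 k (by simp)]
    simp only [phi, if_true, Nat.cast_zero, zero_mul, add_zero, div_one, mul_pow]
    field_simp
  · have hc' : (0 : ℝ) < c := by exact_mod_cast hc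
    have h1 : Tendsto (fun x : ℝ => (1 + (c : ℝ) * x) ^ (-(ν / c))) atTop (nhds 0) :=
      (tendsto_rpow_neg_atTop (by positivity)).comp
        (tendsto_atTop_add_const_left _ _ (tendsto_id.const_mul_atTop hc'))
    have h2 := h1.const_mul (stepProd ν c k / k.factorial * (1 / c : ℝ) ^ k)
    rw [mul_zero] at h2
    refine squeeze_zero' ?_ ?_ h2
    · filter_upwards [eventually_ge_atTop 0] with x hx using basisFun_nonneg hν.le c k hx
    · filter_upwards [eventually_ge_atTop 0] with x hx
      have h := domain_of_nonneg c hx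
      rw [basisFun_eq ν c k h, phi, if_neg hc.ne']
      have := stepProd_nonneg hν.le c k
      have h3 : x / (1 + c * x) ≤ 1 / c := by
        rw [div_le_div_iff₀ h hc']
        linarith
      gcongr

/-- All `p_{ν+c,k}` have the same integral: `-(1/ν) ∑_{j ≤ k} p_{ν,j}` is an antiderivative, which
vanishes at infinity. -/
lemma integral_basisFun {ν : ℝ} (hν : 0 < ν) (c k : ℕ) :
    IntegrableOn (basisFun (ν + c) c k) (Ioi 0) ∧
      ∫ t in Ioi (0 : ℝ), basisFun (ν + c) c k t = 1 / ν := by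
  have hd : ∀ x ∈ Ici (0 : ℝ), HasDerivAt
      (fun y => -(1 / ν) * ∑ j ∈ Finset.range (k + 1), basisFun ν c j y)
      (basisFun (ν + c) c k x) x := fun x hx => by
    refine ((hasDerivAt_sum_basisFun ν c k
      (domain_of_nonneg c hx)).const_mul (-(1 / ν))).congr_deriv ?_
    field_simp
  have hpos : ∀ x ∈ Ioi (0 : ℝ), 0 ≤ basisFun (ν + c) c k x := fun x hx =>
    basisFun_nonneg (by positivity) c k (le_of_lt hx)
  have hlim : Tendsto (fun y => -(1 / ν) * ∑ j ∈ Finset.range (k + 1), basisFun ν c j y)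
      atTop (nhds 0) := by
    have := (tendsto_finsetSum (Finset.range (k + 1)) fun j _ =>
      tendsto_basisFun_atTop hν c j).const_mul (-(1 / ν))
    simpa using this
  refine ⟨integrableOn_Ioi_deriv_of_nonneg' hd hpos hlim, ?_⟩
  rw [integral_Ioi_of_hasDerivAt_of_nonneg' hd hpos hlim]
  simp [basisFun_zero_right]

/-- The ratio test, uniformly in `c`: the ratio tends to `c x / (1 + c x) < 1`. -/
lemma summable_coeff {ν : ℝ} (hν : 0 < ν) (c : ℕ) {x : ℝ} (hx : 0 ≤ x) :
    Summable fun k : ℕ => stepProd ν c k / k.factorial * (x / (1 + c * x)) ^ k := by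
  have h := domain_of_nonneg c hx
  rcases hx.eq_or_lt with rfl | hx
  · refine summable_of_ne_finset_zero (s := {0}) fun k hk => ?_
    have : k ≠ 0 := by simpa using hk
    simp [this]
  have hz : 0 < x / (1 + c * x) := by positivity
  have hpos : ∀ k : ℕ, 0 < stepProd ν c k / k.factorial * (x / (1 + c * x)) ^ k := fun k => by
    have := stepProd_pos hν c k
    positivity
  refine summable_of_ratio_test_tendsto_lt_one (l := c * (x / (1 + c * x))) ?_
    (Eventually.of_forall fun k => (hpos k).ne') ?_
  · rw [mul_div_assoc', div_lt_one h]; linarith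
  · have h1 : Tendsto (fun k : ℕ => (ν + k * c) / (k + 1 : ℝ)) atTop (nhds c) := by
      have h2 : Tendsto (fun k : ℕ => (ν - c) * (1 / ((k : ℝ) + 1)) + c) atTop
          (nhds ((ν - c) * 0 + c)) :=
        (tendsto_one_div_add_atTop_nhds_zero_nat.const_mul _).add_const _
      rw [mul_zero, zero_add] at h2
      refine h2.congr fun k => ?_
      field_simp
      ring
    refine (h1.mul_const (x / (1 + c * x))).congr fun k => ?_
    rw [Real.norm_of_nonneg (hpos _).le, Real.norm_of_nonneg (hpos _).le, stepProd_succ,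
      Nat.factorial_succ, pow_succ]
    have := stepProd_pos hν c k
    push_cast
    field_simp

lemma summable_basisFun {ν : ℝ} (hν : 0 < ν) (c : ℕ) {x : ℝ} (hx : 0 ≤ x) :
    Summable fun k => basisFun ν c k x := by
  simp_rw [fun k => basisFun_eq ν c k (domain_of_nonneg c hx)]
  exact (summable_coeff hν c hx).mul_right _

lemma phi_le_one {ν : ℝ} (hν : 0 ≤ ν) (c : ℕ) {x : ℝ} (hx : 0 ≤ x) : phi ν c x ≤ 1 := by
  unfold phi
  split_ifs
  · exact Real.exp_le_one_iff.2 (by have := mul_nonneg hν hx; linarith)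
  · refine Real.rpow_le_one_of_one_le_of_nonpos ?_ (by simp; positivity)
    have : 0 ≤ (c : ℝ) * x := by positivity
    linarith

/-- The basis functions form a partition of unity: by the telescoping derivative, the remainder
`1 - ∑_{j ≤ k} p_{ν,j}(x)` is at most `ν x` times the maximum of `p_{ν+c,k}` on `[0,x]`. -/
lemma hasSum_basisFun {ν : ℝ} (hν : 0 < ν) (c : ℕ) {x : ℝ} (hx : 0 ≤ x) :
    HasSum (fun k => basisFun ν c k x) 1 := by
  have hs := (summable_basisFun hν c hx).hasSum.tendsto_sum_nat
  suffices h : Tendsto (fun n => ∑ i ∈ Finset.range n, basisFun ν c i x) atTop (nhds 1) by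
    have := (summable_basisFun hν c hx).hasSum
    rwa [tendsto_nhds_unique hs h] at this
  rw [← tendsto_add_atTop_iff_nat 1, ← tendsto_sub_nhds_zero_iff]
  have hνc : 0 < ν + c := by positivity
  have hz := ((summable_coeff hνc c hx).tendsto_atTop_zero.const_mul (ν * x))
  rw [mul_zero] at hz
  refine squeeze_zero_norm (fun k => ?_) hz
  have hb := (convex_Icc (0 : ℝ) x).norm_image_sub_le_of_norm_hasDerivWithin_le
    (f := fun y => ∑ j ∈ Finset.range (k + 1), basisFun ν c j y)
    (f' := fun y => -ν * basisFun (ν + c) c k y)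
    (C := ν * (stepProd (ν + c) c k / k.factorial * (x / (1 + c * x)) ^ k)) (x := 0) (y := x)
    (fun y hy => (hasDerivAt_sum_basisFun ν c k (domain_of_nonneg c hy.1)).hasDerivWithinAt)
    (fun y hy => ?_) ⟨le_rfl, hx⟩ ⟨hx, le_rfl⟩
  · have h0 : ∑ j ∈ Finset.range (k + 1), basisFun ν c j 0 = 1 := by
      simp [basisFun_zero_right]
    rw [h0, sub_zero, Real.norm_of_nonneg hx] at hb
    refine hb.trans (le_of_eq (by ring))
  · have hy1 := domain_of_nonneg c hy.1
    have hx1 := domain_of_nonneg c hx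
    have h3 := basisFun_nonneg hνc.le c k hy.1
    rw [norm_mul, norm_neg, Real.norm_of_nonneg hν.le, Real.norm_of_nonneg h3,
      basisFun_eq _ c k hy1]
    refine mul_le_mul_of_nonneg_left ?_ hν.le
    have h4 := stepProd_nonneg hνc.le c k
    have h5 : y / (1 + c * y) ≤ x / (1 + c * x) := by
      rw [div_le_div_iff₀ hy1 hx1]; nlinarith [hy.2]
    have h6 : 0 ≤ y / (1 + c * y) := div_nonneg hy.1 hy1.le
    calc _ ≤ stepProd (ν + c) c k / k.factorial * (x / (1 + c * x)) ^ k * 1 := by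
          have := phi_le_one hνc.le c hy.1
          have := (phi_pos (ν + c) c hy1).le
          gcongr
      _ = _ := mul_one _

lemma basisFun_mul_descFactorial (ν : ℝ) (c j k : ℕ) {x : ℝ} (hx : 0 < 1 + c * x) :
    basisFun ν c (k + j) x * (k + j).descFactorial j =
      stepProd ν c j * x ^ j * basisFun (ν + j * c) c k x := by
  rw [basisFun_eq' ν c (k + j) hx, basisFun_eq' _ c k hx, add_comm k j, stepProd_add]
  have h1 := Nat.factorial_mul_descFactorial (n := j + k) (k := j) (by lia)
  rw [Nat.add_sub_cancel_left] at h1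
  have h2 : ((j + k).factorial : ℝ) = k.factorial * (j + k).descFactorial j := by
    exact_mod_cast h1.symm
  have h3 : ((j + k).descFactorial j : ℝ) ≠ 0 := by
    rw [Nat.cast_ne_zero, Ne, Nat.descFactorial_eq_zero_iff_lt]
    lia
  have h4 : (k.factorial : ℝ) ≠ 0 := by positivity
  rw [h2, show ν + j * c + k * c = ν + (j + k : ℕ) * c by push_cast; ring]
  field_simp
  ring

/-- The factorial moments of the weights `p_{ν,k}(x)`. -/
lemma hasSum_basisFun_mul_descFactorial {ν : ℝ} (hν : 0 < ν) (c j : ℕ) {x : ℝ} (hx : 0 ≤ x) :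
    HasSum (fun k => basisFun ν c k x * k.descFactorial j) (stepProd ν c j * x ^ j) := by
  rw [← hasSum_nat_add_iff' j]
  have h0 : ∑ i ∈ Finset.range j, basisFun ν c i x * (i.descFactorial j : ℝ) = 0 :=
    Finset.sum_eq_zero fun i hi => by
      rw [Nat.descFactorial_eq_zero_iff_lt.2 (Finset.mem_range.1 hi)]; simp
  rw [h0, sub_zero]
  simp_rw [fun k => basisFun_mul_descFactorial ν c j k (domain_of_nonneg c hx)]
  simpa using (hasSum_basisFun (ν := ν + j * c) (by positivity) c hx).mul_left
    (stepProd ν c j * x ^ j)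

lemma cast_descFactorial_succ (k j : ℕ) :
    (k.descFactorial (j + 1) : ℝ) = (k - j) * k.descFactorial j := by
  rw [Nat.descFactorial_succ]
  rcases le_or_gt j k with h | h
  · push_cast [Nat.cast_sub h]; ring
  · rw [Nat.descFactorial_eq_zero_iff_lt.2 h]; simp

lemma summable_basisFun_mul_ascFactorial {ν : ℝ} (hν : 0 < ν) (c N : ℕ) {x : ℝ} (hx : 0 ≤ x) :
    Summable fun k => basisFun ν c k x * k.ascFactorial N := by
  suffices h : ∀ j, Summable fun k =>
      basisFun ν c k x * (k.descFactorial j * k.ascFactorial N) by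
    simpa using h 0
  induction N with
  | zero => intro j; simpa using (hasSum_basisFun_mul_descFactorial hν c j hx).summable
  | succ N ih =>
    intro j
    refine ((ih (j + 1)).add ((ih j).mul_left (j + N : ℝ))).congr fun k => ?_
    rw [Nat.ascFactorial_succ, cast_descFactorial_succ]
    push_cast
    ring

lemma pow_mul_basisFun (ν : ℝ) (c k N : ℕ) (hν : stepProd (ν - N * c) c N ≠ 0) {t : ℝ}
    (ht : 0 < 1 + c * t) :
    t ^ N * basisFun ν c k t = (k + 1).ascFactorial N / stepProd (ν - N * c) c N *
      basisFun (ν - N * c) c (N + k) t := by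
  rw [basisFun_eq' _ c k ht, basisFun_eq' _ c (N + k) ht, stepProd_add]
  have h1 : ((N + k).factorial : ℝ) = k.factorial * (k + 1).ascFactorial N := by
    rw [add_comm]; exact_mod_cast (Nat.factorial_mul_ascFactorial k N).symm
  have h2 : ((k + 1).ascFactorial N : ℝ) ≠ 0 := by
    exact_mod_cast (Nat.ascFactorial_pos k N).ne'
  have h4 : (k.factorial : ℝ) ≠ 0 := by positivity
  generalize hD : stepProd (ν - N * c) c N = D at hν ⊢
  rw [h1, sub_add_cancel, show ν - N * c + (N + k : ℕ) * c = ν + k * c by push_cast; ring]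
  field_simp
  ring

lemma stepProd_sub (ν : ℝ) (c N : ℕ) :
    stepProd (ν + 2 * c - N * c) c N * (ν + c - N * c) =
      (ν + c) * ∏ i ∈ Finset.range N, (ν - i * c) := by
  induction N with
  | zero => simp [stepProd]
  | succ N ih =>
    rw [Finset.prod_range_succ, ← mul_assoc, ← ih, stepProd_succ']
    push_cast
    rw [show ν + 2 * c - (N + 1) * c + c = ν + 2 * c - N * c by ring]
    ring

/-- The power moments of the densities `(ν + c) p_{ν+2c,k}`. -/
lemma integral_pow_mul_basisFun (c k N : ℕ) {ν : ℝ} (hν : N * c < ν) :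
    IntegrableOn (fun t => t ^ N * basisFun (ν + 2 * c) c k t) (Ioi 0) ∧
      (ν + c) * ∫ t in Ioi (0 : ℝ), t ^ N * basisFun (ν + 2 * c) c k t =
        (k + 1).ascFactorial N / ∏ i ∈ Finset.range N, (ν - i * c) := by
  have hc : (0 : ℝ) ≤ c := by positivity
  have hp := stepProd_pos (ν := ν + 2 * c - N * c) (by linarith) c N
  have hpos : 0 < ν + c - N * c := by linarith
  have h0 : 0 < ν + c := by have : 0 ≤ (N : ℝ) * c := by positivity
                            linarith
  have h := integral_basisFun hpos c (N + k)
  rw [show ν + c - N * c + c = ν + 2 * c - N * c by ring] at h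
  have heq : EqOn (fun t => (k + 1).ascFactorial N / stepProd (ν + 2 * c - N * c) c N *
      basisFun (ν + 2 * c - N * c) c (N + k) t) (fun t => t ^ N * basisFun (ν + 2 * c) c k t)
      (Ioi 0) := fun t ht =>
    (pow_mul_basisFun (ν + 2 * c) c k N hp.ne' (domain_of_nonneg c (le_of_lt ht))).symm
  refine ⟨IntegrableOn.congr_fun (h.1.const_mul _) heq measurableSet_Ioi, ?_⟩
  rw [← setIntegral_congr_fun measurableSet_Ioi heq, integral_const_mul, h.2]
  have hs := stepProd_sub ν c N
  have h3 : ∏ i ∈ Finset.range N, (ν - i * (c : ℝ)) ≠ 0 := by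
    intro h; rw [h, mul_zero] at hs; exact (mul_pos hp hpos).ne' hs
  generalize stepProd (ν + 2 * c - N * c) c N = D at hs hp ⊢
  generalize ∏ i ∈ Finset.range N, (ν - i * (c : ℝ)) = E at hs h3 ⊢
  generalize ν + c - N * c = F at hs hpos ⊢
  field_simp
  linear_combination -hs

/-! ### The operator as an expectation -/

/-- The laws over which the operator averages: `δ_0` for `k = 0`, and the law on `(0,∞)` with
density `(ν + c) p_{ν+2c,k-1}` for `k ≥ 1`. -/
noncomputable def densityLaw (ν : ℝ) (c : ℕ) : ℕ → Measure ℝ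
  | 0 => Measure.dirac 0
  | k + 1 => (volume.restrict (Ioi 0)).withDensity
      fun t => ENNReal.ofReal ((ν + c) * basisFun (ν + 2 * c) c k t)

/-- The mixture of the laws `densityLaw ν c k` with weights `w k`. -/
noncomputable def mixture (ν : ℝ) (c : ℕ) (w : ℕ → ℝ) : Measure ℝ :=
  Measure.sum fun k => ENNReal.ofReal (w k) • densityLaw ν c k

lemma aemeasurable_density (ν : ℝ) (c k : ℕ) :
    AEMeasurable (fun t => ENNReal.ofReal ((ν + c) * basisFun (ν + 2 * c) c k t))
      (volume.restrict (Ioi 0)) :=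
  ((((continuousOn_basisFun _ c k).mono Ioi_subset_Ici_self).aemeasurable
    measurableSet_Ioi).const_mul _).ennreal_ofReal

lemma toReal_density_ae {ν : ℝ} (hν : 0 < ν) (c k : ℕ) (f : ℝ → ℝ) :
    (fun t => (ENNReal.ofReal ((ν + c) * basisFun (ν + 2 * c) c k t)).toReal • f t)
      =ᵐ[volume.restrict (Ioi 0)]
        fun t => (ν + c) * (basisFun (ν + 2 * c) c k t * f t) := by
  filter_upwards [ae_restrict_mem measurableSet_Ioi] with t ht
  have := basisFun_nonneg (ν := ν + 2 * c) (by positivity) c k (le_of_lt ht)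
  rw [ENNReal.toReal_ofReal (by positivity), smul_eq_mul, mul_assoc]

lemma integrable_densityLaw_succ {ν : ℝ} (hν : 0 < ν) (c k : ℕ) (f : ℝ → ℝ) :
    Integrable f (densityLaw ν c (k + 1)) ↔
      IntegrableOn (fun t => basisFun (ν + 2 * c) c k t * f t) (Ioi 0) := by
  rw [densityLaw, integrable_withDensity_iff_integrable_smul₀' (aemeasurable_density ν c k)
    (by simp), integrable_congr (toReal_density_ae hν c k f)]
  have h : (ν + c : ℝ) ≠ 0 := by positivity
  exact integrable_const_mul_iff (Ne.isUnit h) _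

lemma integral_densityLaw_succ {ν : ℝ} (hν : 0 < ν) (c k : ℕ) (f : ℝ → ℝ) :
    ∫ t, f t ∂densityLaw ν c (k + 1) =
      (ν + c) * ∫ t in Ioi (0 : ℝ), basisFun (ν + 2 * c) c k t * f t := by
  rw [densityLaw, integral_withDensity_eq_integral_toReal_smul₀ (aemeasurable_density ν c k)
    (by simp), integral_congr_ae (toReal_density_ae hν c k f), integral_const_mul]

lemma ae_nonneg_densityLaw (ν : ℝ) (c k : ℕ) : ∀ᵐ t ∂densityLaw ν c k, 0 ≤ t := by
  cases k with
  | zero => simp [densityLaw]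
  | succ k =>
    refine (withDensity_absolutelyContinuous _ _).ae_le ?_
    filter_upwards [ae_restrict_mem measurableSet_Ioi] with t ht using le_of_lt ht

lemma aestronglyMeasurable_densityLaw (ν : ℝ) (c k : ℕ) {f : ℝ → ℝ}
    (hf : AEStronglyMeasurable f (volume.restrict (Ioi 0))) :
    AEStronglyMeasurable f (densityLaw ν c k) := by
  cases k with
  | zero => exact aestronglyMeasurable_dirac
  | succ k => exact hf.mono_ac (withDensity_absolutelyContinuous _ _)

/-- The power moments of the laws `densityLaw ν c k`. -/
lemma moment_densityLaw (c k N : ℕ) {ν : ℝ} (h0 : 0 < ν) (hν : N * c < ν) :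
    Integrable (fun t => t ^ N) (densityLaw ν c k) ∧
      ∫ t, t ^ N ∂densityLaw ν c k =
        k.ascFactorial N / ∏ i ∈ Finset.range N, (ν - i * c) := by
  cases k with
  | zero =>
    refine ⟨integrable_dirac (by simp), ?_⟩
    rw [densityLaw, integral_dirac]
    cases N <;> simp [Nat.zero_ascFactorial]
  | succ k =>
    have h := integral_pow_mul_basisFun c k N hν
    simp_rw [mul_comm (_ ^ N) (basisFun _ _ _ _)] at h
    rw [integrable_densityLaw_succ h0, integral_densityLaw_succ h0]
    exact h

lemma isProbabilityMeasure_densityLaw (c k : ℕ) {ν : ℝ} (hν : 0 < ν) :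
    IsProbabilityMeasure (densityLaw ν c k) := by
  have h := moment_densityLaw c k 0 hν (by simpa using hν)
  simp only [pow_zero, integral_const, smul_eq_mul, mul_one, Finset.range_zero,
    Finset.prod_empty, Nat.ascFactorial_zero, Nat.cast_one, div_one] at h
  constructor
  have h2 := h.2
  rw [Measure.real, ENNReal.toReal_eq_one_iff] at h2
  exact h2

section Mixture

variable {ν : ℝ} {c : ℕ} {w : ℕ → ℝ}

lemma isProbabilityMeasure_mixture (hν : 0 < ν) (hw : ∀ k, 0 ≤ w k) (h1 : HasSum w 1) :
    IsProbabilityMeasure (mixture ν c w) := by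
  constructor
  have := fun k => isProbabilityMeasure_densityLaw c k hν
  rw [mixture, Measure.sum_apply _ MeasurableSet.univ]
  simp only [Measure.smul_apply, measure_univ, smul_eq_mul, mul_one]
  rw [← ENNReal.ofReal_tsum_of_nonneg hw h1.summable, h1.tsum_eq, ENNReal.ofReal_one]

lemma ae_nonneg_mixture : ∀ᵐ t ∂mixture ν c w, 0 ≤ t := by
  rw [mixture, Measure.ae_sum_iff]
  exact fun k => Measure.ae_smul_measure (ae_nonneg_densityLaw ν c k) _

lemma mixture_le {w' : ℕ → ℝ} {α : ℝ} (hα : 0 ≤ α) (h : ∀ k, w k ≤ α * w' k) :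
    mixture ν c w ≤ ENNReal.ofReal α • mixture ν c w' := by
  refine Measure.le_iff.2 fun s hs => ?_
  rw [mixture, mixture, Measure.smul_apply, Measure.sum_apply _ hs, Measure.sum_apply _ hs,
    smul_eq_mul, ← ENNReal.tsum_mul_left]
  refine ENNReal.tsum_le_tsum fun k => ?_
  rw [Measure.smul_apply, Measure.smul_apply, smul_eq_mul, smul_eq_mul, ← mul_assoc,
    ← ENNReal.ofReal_mul hα]
  gcongr
  exact h k

lemma integrable_mixture {f : ℝ → ℝ} (hw : ∀ k, 0 ≤ w k)
    (hf : ∀ k, Integrable f (densityLaw ν c k))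
    (hs : Summable fun k => w k * ∫ t, |f t| ∂densityLaw ν c k) :
    Integrable f (mixture ν c w) := by
  refine integrable_sum_measure (fun k => (hf k).smul_measure ENNReal.ofReal_ne_top) ?_
  refine hs.congr fun k => ?_
  rw [integral_smul_measure, ENNReal.toReal_ofReal (hw k), smul_eq_mul]
  rfl

lemma hasSum_mixture {f : ℝ → ℝ} (hw : ∀ k, 0 ≤ w k) (hf : Integrable f (mixture ν c w)) :
    HasSum (fun k => w k * ∫ t, f t ∂densityLaw ν c k) (∫ t, f t ∂mixture ν c w) := by
  have := hasSum_integral_measure hf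
  simp only [integral_smul_measure, ENNReal.toReal_ofReal (hw _), smul_eq_mul] at this
  exact this

end Mixture

/-- The mixture with the weights `p_{ν,k}(x)`; integration against it is the case `α = 1` of the
operator. -/
noncomputable def baseLaw (ν : ℝ) (c : ℕ) (x : ℝ) : Measure ℝ :=
  mixture ν c fun k => basisFun ν c k x

/-- The mixture with the Bézier weights `Q_{ν,k}^{(α)}(x)`. -/
noncomputable def bezierLaw (ν : ℝ) (c : ℕ) (α x : ℝ) : Measure ℝ :=
  mixture ν c fun k => bezierWeight ν c α k x

section Law

variable {ν : ℝ} {c : ℕ} {x : ℝ}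

lemma moment_baseLaw (N : ℕ) (h0 : 0 < ν) (hν : N * c < ν) (hx : 0 ≤ x) :
    Integrable (fun t => t ^ N) (baseLaw ν c x) ∧
      HasSum (fun k => basisFun ν c k x * k.ascFactorial N)
        ((∏ i ∈ Finset.range N, (ν - i * c)) * ∫ t, t ^ N ∂baseLaw ν c x) := by
  have hm := fun k => moment_densityLaw c k N h0 hν
  have hp : ∏ i ∈ Finset.range N, (ν - i * c) ≠ 0 := by
    refine Finset.prod_ne_zero_iff.2 fun i hi => ?_
    have : (i : ℝ) * c ≤ N * c := by
      gcongr; exact (Finset.mem_range.1 hi).le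
    linarith
  have hb := fun k => basisFun_nonneg h0.le c k hx
  have hint : Integrable (fun t => t ^ N) (baseLaw ν c x) := by
    refine integrable_mixture hb (fun k => (hm k).1) ?_
    refine ((summable_basisFun_mul_ascFactorial h0 c N hx).mul_right
      (∏ i ∈ Finset.range N, (ν - i * c))⁻¹).congr fun k => ?_
    have : ∫ t, |t ^ N| ∂densityLaw ν c k = ∫ t, t ^ N ∂densityLaw ν c k :=
      integral_congr_ae (by
        filter_upwards [ae_nonneg_densityLaw ν c k] with t ht
        exact abs_of_nonneg (by positivity))
    rw [this, (hm k).2]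
    ring
  refine ⟨hint, ?_⟩
  have h := (hasSum_mixture hb hint).mul_left (∏ i ∈ Finset.range N, (ν - i * c))
  refine h.congr_fun fun k => ?_
  rw [(hm k).2]
  generalize ∏ i ∈ Finset.range N, (ν - i * c) = D at hp ⊢
  field_simp

lemma isProbabilityMeasure_baseLaw (h0 : 0 < ν) (hx : 0 ≤ x) :
    IsProbabilityMeasure (baseLaw ν c x) :=
  isProbabilityMeasure_mixture h0 (fun k => basisFun_nonneg h0.le c k hx)
    (hasSum_basisFun h0 c hx)

lemma cast_ascFactorial_two (k : ℕ) :
    (k.ascFactorial 2 : ℝ) = k.descFactorial 2 + 2 * k.descFactorial 1 := by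
  simp only [Nat.ascFactorial_succ, cast_descFactorial_succ, Nat.ascFactorial_zero,
    Nat.descFactorial_zero]
  push_cast
  ring

lemma cast_ascFactorial_three (k : ℕ) :
    (k.ascFactorial 3 : ℝ) =
      k.descFactorial 3 + 6 * k.descFactorial 2 + 6 * k.descFactorial 1 := by
  simp only [Nat.ascFactorial_succ, cast_descFactorial_succ, Nat.ascFactorial_zero,
    Nat.descFactorial_zero]
  push_cast
  ring

lemma cast_ascFactorial_four (k : ℕ) :
    (k.ascFactorial 4 : ℝ) = k.descFactorial 4 + 12 * k.descFactorial 3 +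
      36 * k.descFactorial 2 + 24 * k.descFactorial 1 := by
  simp only [Nat.ascFactorial_succ, cast_descFactorial_succ, Nat.ascFactorial_zero,
    Nat.descFactorial_zero]
  push_cast
  ring

lemma integral_baseLaw (h0 : 0 < ν) (hν : c < ν) (hx : 0 ≤ x) :
    ∫ t, t ∂baseLaw ν c x = x := by
  have h := (moment_baseLaw (c := c) 1 h0 (by simpa using hν) hx).2
  have h2 := hasSum_basisFun_mul_descFactorial h0 c 1 hx
  have e : ∀ k : ℕ, k.ascFactorial 1 = k.descFactorial 1 := fun k => by
    simp [Nat.ascFactorial_succ]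
  simp_rw [e] at h
  have h3 := h.unique h2
  simp only [pow_one, Finset.prod_range_one, Nat.cast_zero, zero_mul, sub_zero, stepProd,
    add_zero] at h3
  exact mul_left_cancel₀ h0.ne' h3

lemma integral_sq_baseLaw (h0 : 0 < ν) (hν : 2 * c < ν) (hx : 0 ≤ x) :
    ν * (ν - c) * ∫ t, t ^ 2 ∂baseLaw ν c x = ν * (ν + c) * x ^ 2 + 2 * (ν * x) := by
  have h := (moment_baseLaw (c := c) 2 h0 (by simpa using hν) hx).2
  have h2 := (hasSum_basisFun_mul_descFactorial h0 c 2 hx).add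
    ((hasSum_basisFun_mul_descFactorial h0 c 1 hx).mul_left 2)
  have h3 := h.unique (h2.congr_fun fun k => by rw [cast_ascFactorial_two]; ring)
  simp only [Finset.prod_range_succ, Finset.prod_range_zero, stepProd] at h3
  push_cast at h3
  linear_combination h3

lemma integral_cube_baseLaw (h0 : 0 < ν) (hν : 3 * c < ν) (hx : 0 ≤ x) :
    ν * (ν - c) * (ν - 2 * c) * ∫ t, t ^ 3 ∂baseLaw ν c x =
      ν * (ν + c) * (ν + 2 * c) * x ^ 3 + 6 * (ν * (ν + c) * x ^ 2) + 6 * (ν * x) := by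
  have h := (moment_baseLaw (c := c) 3 h0 (by simpa using hν) hx).2
  have h2 := ((hasSum_basisFun_mul_descFactorial h0 c 3 hx).add
    ((hasSum_basisFun_mul_descFactorial h0 c 2 hx).mul_left 6)).add
    ((hasSum_basisFun_mul_descFactorial h0 c 1 hx).mul_left 6)
  have h3 := h.unique (h2.congr_fun fun k => by rw [cast_ascFactorial_three]; ring)
  simp only [Finset.prod_range_succ, Finset.prod_range_zero, stepProd] at h3
  push_cast at h3
  linear_combination h3

lemma integral_fourth_baseLaw (h0 : 0 < ν) (hν : 4 * c < ν) (hx : 0 ≤ x) :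
    ν * (ν - c) * (ν - 2 * c) * (ν - 3 * c) * ∫ t, t ^ 4 ∂baseLaw ν c x =
      ν * (ν + c) * (ν + 2 * c) * (ν + 3 * c) * x ^ 4 +
        12 * (ν * (ν + c) * (ν + 2 * c) * x ^ 3) + 36 * (ν * (ν + c) * x ^ 2) +
        24 * (ν * x) := by
  have h := (moment_baseLaw (c := c) 4 h0 (by simpa using hν) hx).2
  have h2 := (((hasSum_basisFun_mul_descFactorial h0 c 4 hx).add
    ((hasSum_basisFun_mul_descFactorial h0 c 3 hx).mul_left 12)).add
    ((hasSum_basisFun_mul_descFactorial h0 c 2 hx).mul_left 36)).add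
    ((hasSum_basisFun_mul_descFactorial h0 c 1 hx).mul_left 24)
  have h3 := h.unique (h2.congr_fun fun k => by rw [cast_ascFactorial_four]; ring)
  simp only [Finset.prod_range_succ, Finset.prod_range_zero, stepProd] at h3
  push_cast at h3
  linear_combination h3

/-- Every central moment of the base law is finite once `ν` is large. -/
lemma integrable_sub_pow_baseLaw (N : ℕ) (h0 : 0 < ν) (hν : N * c < ν) (hx : 0 ≤ x) :
    Integrable (fun t => (t - x) ^ N) (baseLaw ν c x) := by
  simp_rw [sub_eq_add_neg, add_pow]
  refine integrable_finsetSum _ fun i hi => ?_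
  refine Integrable.mul_const (Integrable.mul_const (moment_baseLaw i h0 ?_ hx).1 _) _
  refine lt_of_le_of_lt ?_ hν
  have : i ≤ N := by have := Finset.mem_range.1 hi; lia
  gcongr

lemma integral_sub_baseLaw (h0 : 0 < ν) (hν : c < ν) (hx : 0 ≤ x) :
    ∫ t, (t - x) ∂baseLaw ν c x = 0 := by
  have := isProbabilityMeasure_baseLaw (c := c) h0 hx
  have hi := (moment_baseLaw (c := c) 1 h0 (by simpa using hν) hx).1
  simp only [pow_one] at hi
  rw [integral_sub hi (integrable_const _), integral_baseLaw h0 hν hx]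
  simp

lemma integral_sub_sq_baseLaw (h0 : 0 < ν) (hν : 2 * c < ν) (hx : 0 ≤ x) :
    ∫ t, (t - x) ^ 2 ∂baseLaw ν c x = 2 * (x * (1 + c * x)) / (ν - c) := by
  have := isProbabilityMeasure_baseLaw (c := c) h0 hx
  have hc : (0 : ℝ) ≤ c := by positivity
  have i1 := (moment_baseLaw (c := c) 1 h0 (by push_cast; linarith) hx).1
  have i2 := (moment_baseLaw (c := c) 2 h0 (by push_cast; linarith) hx).1
  have e : (fun t : ℝ => (t - x) ^ 2) = fun t => t ^ 2 - 2 * x * t ^ 1 + x ^ 2 := by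
    ext t; ring
  rw [e, integral_add (by fun_prop) (by fun_prop), integral_sub (by fun_prop) (by fun_prop),
    integral_const_mul]
  simp only [pow_one]
  rw [integral_baseLaw h0 (by linarith) hx]
  have h2 := integral_sq_baseLaw h0 hν hx
  have h3 : ν - c ≠ 0 := by linarith
  simp only [integral_const, probReal_univ, one_smul]
  rw [eq_div_iff h3]
  refine mul_left_cancel₀ h0.ne' ?_
  linear_combination h2

lemma integral_sub_fourth_baseLaw (h0 : 0 < ν) (hν : 4 * c < ν) (hx : 0 ≤ x) :
    ∫ t, (t - x) ^ 4 ∂baseLaw ν c x =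
      (24 * x + (12 * ν + 108 * c) * x ^ 2 + (24 * ν + 168 * c) * c * x ^ 3 +
        (12 * ν + 84 * c) * c ^ 2 * x ^ 4) / ((ν - c) * (ν - 2 * c) * (ν - 3 * c)) := by
  have := isProbabilityMeasure_baseLaw (c := c) h0 hx
  have hc : (0 : ℝ) ≤ c := by positivity
  have i1 := (moment_baseLaw (c := c) 1 h0 (by push_cast; linarith) hx).1
  have i2 := (moment_baseLaw (c := c) 2 h0 (by push_cast; linarith) hx).1
  have i3 := (moment_baseLaw (c := c) 3 h0 (by push_cast; linarith) hx).1
  have i4 := (moment_baseLaw (c := c) 4 h0 (by push_cast; linarith) hx).1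
  have e : (fun t : ℝ => (t - x) ^ 4) =
      fun t => t ^ 4 - 4 * x * t ^ 3 + 6 * x ^ 2 * t ^ 2 - 4 * x ^ 3 * t ^ 1 + x ^ 4 := by
    ext t; ring
  rw [e, integral_add (by fun_prop) (by fun_prop), integral_sub (by fun_prop) (by fun_prop),
    integral_add (by fun_prop) (by fun_prop), integral_sub (by fun_prop) (by fun_prop),
    integral_const_mul, integral_const_mul,
    integral_const_mul]
  simp only [pow_one]
  rw [integral_baseLaw h0 (by linarith) hx]
  have h2 := integral_sq_baseLaw h0 (by linarith) hx (c := c)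
  have h3 := integral_cube_baseLaw h0 (by linarith) hx (c := c)
  have h4 := integral_fourth_baseLaw h0 hν hx
  have n1 : ν - c ≠ 0 := by linarith
  have n2 : ν - 2 * c ≠ 0 := by linarith
  have n3 : ν - 3 * c ≠ 0 := by linarith
  simp only [integral_const, probReal_univ, one_smul]
  rw [eq_div_iff (by positivity)]
  refine mul_left_cancel₀ h0.ne' ?_
  linear_combination h4 - 4 * x * (ν - 3 * c) * h3 +
    6 * x ^ 2 * (ν - 2 * c) * (ν - 3 * c) * h2

end Law

/-! ### Bézier weights -/

section Weights

variable {ν : ℝ} {c : ℕ} {x : ℝ} {α : ℝ}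

lemma tailSum_zero (hν : 0 < ν) (hx : 0 ≤ x) : tailSum ν c 0 x = 1 := by
  simpa [tailSum] using (hasSum_basisFun hν c hx).tsum_eq

lemma tailSum_succ (hν : 0 < ν) (hx : 0 ≤ x) (k : ℕ) :
    tailSum ν c k x = basisFun ν c k x + tailSum ν c (k + 1) x := by
  have h : Summable fun j => basisFun ν c (k + j) x := by
    simpa only [add_comm] using (summable_nat_add_iff k).2 (summable_basisFun hν c hx)
  rw [tailSum, h.tsum_eq_zero_add, tailSum, add_zero]
  simp only [add_assoc, add_comm 1]

lemma tailSum_nonneg (hν : 0 < ν) (hx : 0 ≤ x) (k : ℕ) : 0 ≤ tailSum ν c k x :=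
  tsum_nonneg fun _ => basisFun_nonneg hν.le c _ hx

lemma tailSum_le_one (hν : 0 < ν) (hx : 0 ≤ x) (k : ℕ) : tailSum ν c k x ≤ 1 := by
  induction k with
  | zero => exact (tailSum_zero hν hx).le
  | succ k ih =>
    have := basisFun_nonneg hν.le c k hx
    have := tailSum_succ (c := c) hν hx k
    linarith

lemma tendsto_tailSum (ν : ℝ) (c : ℕ) (x : ℝ) :
    Tendsto (fun k => tailSum ν c k x) atTop (nhds 0) := by
  simpa only [tailSum, add_comm] using tendsto_sum_nat_add fun k => basisFun ν c k x

lemma rpow_sub_rpow_le (hα : 1 ≤ α) {a b : ℝ} (ha : 0 ≤ a) (hab : a ≤ b) (hb : b ≤ 1) :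
    b ^ α - a ^ α ≤ α * (b - a) := by
  have h := (convex_Icc (0 : ℝ) 1).norm_image_sub_le_of_norm_hasDerivWithin_le
    (f := fun t => t ^ α) (f' := fun t => α * t ^ (α - 1)) (C := α) (x := a) (y := b)
    (fun t _ => (Real.hasDerivAt_rpow_const (Or.inr hα)).hasDerivWithinAt)
    (fun t ht => ?_) ⟨ha, hab.trans hb⟩ ⟨ha.trans hab, hb⟩
  · rw [Real.norm_of_nonneg (sub_nonneg.2 hab)] at h
    exact (le_abs_self _).trans h
  · have h1 := Real.rpow_le_one ht.1 ht.2 (sub_nonneg.2 hα)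
    have h2 := Real.rpow_nonneg ht.1 (α - 1)
    rw [Real.norm_of_nonneg (by positivity)]
    nlinarith

lemma bezierWeight_nonneg (hν : 0 < ν) (hx : 0 ≤ x) (hα : 1 ≤ α) (k : ℕ) :
    0 ≤ bezierWeight ν c α k x := by
  have h1 := basisFun_nonneg hν.le c k hx
  have h2 := tailSum_succ (c := c) hν hx k
  exact sub_nonneg.2 (Real.rpow_le_rpow (tailSum_nonneg hν hx _) (by linarith) (by linarith))

lemma bezierWeight_le (hν : 0 < ν) (hx : 0 ≤ x) (hα : 1 ≤ α) (k : ℕ) :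
    bezierWeight ν c α k x ≤ α * basisFun ν c k x := by
  have h1 := basisFun_nonneg hν.le c k hx
  have h2 := tailSum_succ (c := c) hν hx k
  refine (rpow_sub_rpow_le hα (tailSum_nonneg hν hx _) (by linarith)
    (tailSum_le_one hν hx k)).trans (le_of_eq ?_)
  rw [h2]; ring

lemma hasSum_bezierWeight (hν : 0 < ν) (hx : 0 ≤ x) (hα : 1 ≤ α) :
    HasSum (fun k => bezierWeight ν c α k x) 1 := by
  rw [hasSum_iff_tendsto_nat_of_nonneg (bezierWeight_nonneg hν hx hα)]
  simp only [bezierWeight, Finset.sum_range_sub', tailSum_zero hν hx, Real.one_rpow]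
  have h := (tendsto_tailSum ν c x).rpow_const (p := α) (Or.inr (by linarith))
  rw [Real.zero_rpow (by linarith)] at h
  simpa using h.const_sub 1

lemma isProbabilityMeasure_bezierLaw (hν : 0 < ν) (hx : 0 ≤ x) (hα : 1 ≤ α) :
    IsProbabilityMeasure (bezierLaw ν c α x) :=
  isProbabilityMeasure_mixture hν (bezierWeight_nonneg hν hx hα) (hasSum_bezierWeight hν hx hα)

lemma bezierLaw_le (hν : 0 < ν) (hx : 0 ≤ x) (hα : 1 ≤ α) :
    bezierLaw ν c α x ≤ ENNReal.ofReal α • baseLaw ν c x :=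
  mixture_le (by linarith) (bezierWeight_le hν hx hα)

end Weights

/-- For functions of polynomial growth the operator converges, and is an expectation under the
Bézier law. -/
lemma bezierOp_eq_integral {n : ℕ} {m : ℤ} {c : ℕ} {α x : ℝ} {N : ℕ} (hα : 1 ≤ α) (hx : 0 ≤ x)
    (h0 : 0 < (n : ℝ) + m * c) (hN : N * c < (n : ℝ) + m * c) {f : ℝ → ℝ}
    (hm : AEStronglyMeasurable f (volume.restrict (Ioi 0))) {C : ℝ}
    (hf : ∀ t, 0 ≤ t → |f t| ≤ C * (1 + t ^ N)) :
    BezierConverges n m c α f x ∧ Integrable f (baseLaw ((n : ℝ) + m * c) c x) ∧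
      bezierOp n m c α f x = ∫ t, f t ∂bezierLaw ((n : ℝ) + m * c) c α x := by
  set ν : ℝ := (n : ℝ) + m * c with hν
  have e1 : (n : ℝ) + ((m : ℝ) + 2) * c = ν + 2 * c := by rw [hν]; ring
  have e2 : (n : ℝ) + ((m : ℝ) + 1) * c = ν + c := by rw [hν]; ring
  have hp := fun k => isProbabilityMeasure_densityLaw c k h0
  have hmom := fun k => moment_densityLaw c k N h0 hN
  have hdom := fun k => ((integrable_const (μ := densityLaw ν c k) (1 : ℝ)).add
    (hmom k).1).const_mul C
  have hfk : ∀ k, Integrable f (densityLaw ν c k) := fun k => by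
    refine (hdom k).mono' (aestronglyMeasurable_densityLaw ν c k hm) ?_
    filter_upwards [ae_nonneg_densityLaw ν c k] with t ht using hf t ht
  have hbase : Integrable f (baseLaw ν c x) := by
    refine integrable_mixture (fun k => basisFun_nonneg h0.le c k hx) hfk ?_
    refine Summable.of_nonneg_of_le (fun k => mul_nonneg (basisFun_nonneg h0.le c k hx)
      (integral_nonneg fun t => abs_nonneg _)) (fun k => mul_le_mul_of_nonneg_left ?_
      (basisFun_nonneg h0.le c k hx))
      (f := fun k => basisFun ν c k x *
        (C * (1 + k.ascFactorial N / ∏ i ∈ Finset.range N, (ν - i * c)))) ?_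
    · refine (integral_mono_ae (hfk k).abs (hdom k) ?_).trans (le_of_eq ?_)
      · filter_upwards [ae_nonneg_densityLaw ν c k] with t ht using hf t ht
      · have := hp k
        simp only [Pi.add_apply]
        rw [integral_const_mul, integral_add (integrable_const _) (hmom k).1, (hmom k).2]
        simp
    · refine (((summable_basisFun h0 c hx).mul_left C).add
        ((summable_basisFun_mul_ascFactorial h0 c N hx).mul_left
          (C / ∏ i ∈ Finset.range N, (ν - i * c)))).congr fun k => ?_
      ring
  have hbez : Integrable f (bezierLaw ν c α x) :=
    hbase.of_measure_le_smul ENNReal.ofReal_ne_top (bezierLaw_le h0 hx hα)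
  have hsum := hasSum_mixture (bezierWeight_nonneg h0 hx hα) hbez
  have hterm : ∀ k, (ν + c) * bezierTerm n m c α f x k =
      bezierWeight ν c α (k + 1) x * ∫ t, f t ∂densityLaw ν c (k + 1) := fun k => by
    rw [bezierTerm, integral_densityLaw_succ h0, e1, ← hν]
    ring
  have hsum1 := (hasSum_nat_add_iff' 1).2 hsum
  have hne : ν + c ≠ 0 := by positivity
  refine ⟨⟨fun k => ?_, ?_⟩, hbase, ?_⟩
  · rw [e1]
    exact (integrable_densityLaw_succ h0 c k f).1 (hfk (k + 1))
  · refine (hsum1.summable.mul_left (ν + c)⁻¹).congr fun k => ?_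
    rw [← hterm]
    field_simp
  · rw [bezierOp, e2, ← hν, ← tsum_mul_left]
    simp_rw [hterm]
    rw [hsum1.tsum_eq, Finset.sum_range_one]
    simp only [densityLaw, integral_dirac, bezierLaw]
    ring

/-- At `x = 0` all weights but the first vanish. -/
lemma bezierOp_zero (n : ℕ) (m : ℤ) (c : ℕ) {α : ℝ} (hα : 1 ≤ α) (f : ℝ → ℝ) :
    bezierOp n m c α f 0 = f 0 := by
  have h0 : ∀ ν : ℝ, tailSum ν c 0 0 = 1 := fun ν => by
    simp [tailSum, basisFun_zero_right]
  have h1 : ∀ (ν : ℝ) (k : ℕ), tailSum ν c (k + 1) 0 = 0 := fun ν k => by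
    simp [tailSum, basisFun_zero_right]
  have hα0 : α ≠ 0 := by linarith
  simp [bezierOp, bezierTerm, bezierWeight, h0, h1, Real.zero_rpow hα0]

/-! ### Moment inequalities and tails -/

section Probability

variable {Ω : Type*} [MeasurableSpace Ω] {μ κ : Measure Ω} {Y : Ω → ℝ}

/-- Cantelli's inequality, the one-sided form of Chebyshev's. -/
lemma meas_ge_le_cantelli [IsProbabilityMeasure μ] (h1 : Integrable Y μ)
    (h2 : Integrable (fun ω => Y ω ^ 2) μ) (h0 : ∫ ω, Y ω ∂μ = 0) {a : ℝ} (ha : 0 < a) :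
    μ.real {ω | a ≤ Y ω} ≤ (∫ ω, Y ω ^ 2 ∂μ) / (∫ ω, Y ω ^ 2 ∂μ + a ^ 2) := by
  set V := ∫ ω, Y ω ^ 2 ∂μ with hV
  have hV0 : 0 ≤ V := integral_nonneg fun ω => sq_nonneg _
  -- Markov's inequality for `(Y + b)²`, with the optimal shift `b = V / a`
  have hb : 0 ≤ V / a := by positivity
  have e : (fun ω => (Y ω + V / a) ^ 2) =
      fun ω => Y ω ^ 2 + 2 * (V / a) * Y ω + (V / a) ^ 2 := by
    ext ω; ring
  have hi : Integrable (fun ω => (Y ω + V / a) ^ 2) μ := by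
    rw [e]; fun_prop
  have hm := mul_meas_ge_le_integral_of_nonneg (μ := μ) (f := fun ω => (Y ω + V / a) ^ 2)
    (ae_of_all _ fun ω => sq_nonneg _) hi ((a + V / a) ^ 2)
  have hsub : μ.real {ω | a ≤ Y ω} ≤ μ.real {ω | (a + V / a) ^ 2 ≤ (Y ω + V / a) ^ 2} :=
    measureReal_mono fun ω (hω : a ≤ Y ω) => by
      show (a + V / a) ^ 2 ≤ (Y ω + V / a) ^ 2
      gcongr
  have hint : ∫ ω, (Y ω + V / a) ^ 2 ∂μ = V + (V / a) ^ 2 := by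
    rw [e, integral_add (by fun_prop) (by fun_prop), integral_add (by fun_prop) (by fun_prop),
      integral_const_mul, h0, ← hV]
    simp
  rw [hint] at hm
  have h3 : (a + V / a) ^ 2 * μ.real {ω | a ≤ Y ω} ≤ V + (V / a) ^ 2 :=
    (mul_le_mul_of_nonneg_left hsub (by positivity)).trans hm
  have hVa : 0 < V + a ^ 2 := by positivity
  rw [le_div_iff₀ hVa]
  have e1 : (a + V / a) ^ 2 = (V + a ^ 2) * ((V + a ^ 2) / a ^ 2) := by field_simp; ring
  have e2 : V + (V / a) ^ 2 = V * ((V + a ^ 2) / a ^ 2) := by field_simp; ring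
  rw [e1, e2] at h3
  have hq : 0 < (V + a ^ 2) / a ^ 2 := by positivity
  refine le_of_mul_le_mul_right ?_ hq
  linarith

lemma meas_ge_le_fourth [IsFiniteMeasure μ] (h4 : Integrable (fun ω => Y ω ^ 4) μ) {a : ℝ}
    (ha : 0 < a) :
    μ.real {ω | a ≤ Y ω} ≤ (∫ ω, Y ω ^ 4 ∂μ) / a ^ 4 := by
  have hm := mul_meas_ge_le_integral_of_nonneg (μ := μ) (f := fun ω => Y ω ^ 4)
    (ae_of_all _ fun ω => by positivity) h4 (a ^ 4)
  have hsub : μ.real {ω | a ≤ Y ω} ≤ μ.real {ω | a ^ 4 ≤ Y ω ^ 4} :=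
    measureReal_mono fun ω (hω : a ≤ Y ω) => by
      show a ^ 4 ≤ Y ω ^ 4
      gcongr
  rw [le_div_iff₀ (by positivity), mul_comm]
  exact (mul_le_mul_of_nonneg_left hsub (by positivity)).trans hm

/-- Chebyshev's bound with the variance `2β/(n + d)` replaced by `2β/n`, also when `d < 0`: the
loss is absorbed by Cantelli's inequality for small `a`, by the fourth moment for large `a`. -/
lemma meas_ge_le_of_moments [IsProbabilityMeasure μ] (h1 : Integrable Y μ)
    (h2 : Integrable (fun ω => Y ω ^ 2) μ) (h4 : Integrable (fun ω => Y ω ^ 4) μ)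
    (h0 : ∫ ω, Y ω ∂μ = 0) {n d β C : ℝ} (hn : 0 < n) (hd : 0 < n + d) (hβ : 0 < β)
    (hV : ∫ ω, Y ω ^ 2 ∂μ = 2 * β / (n + d)) (hF : ∫ ω, Y ω ^ 4 ∂μ ≤ C / n ^ 2)
    (hC : C * -d ≤ 4 * β ^ 2 * n) {a : ℝ} (ha : 0 < a) :
    μ.real {ω | a ≤ Y ω} ≤ 2 * β / (n * a ^ 2) := by
  rcases le_or_gt (a ^ 2 * -d) (2 * β) with h | h
  · refine (meas_ge_le_cantelli h1 h2 h0 ha).trans ?_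
    rw [hV]
    have e : 2 * β / (n + d) / (2 * β / (n + d) + a ^ 2) =
        2 * β / (2 * β + a ^ 2 * (n + d)) := by field_simp
    rw [e]
    refine div_le_div_of_nonneg_left (by positivity) (by positivity) ?_
    linarith
  · refine (meas_ge_le_fourth h4 ha).trans ?_
    have h5 : (∫ ω, Y ω ^ 4 ∂μ) / a ^ 4 ≤ C / n ^ 2 / a ^ 4 := by gcongr
    refine h5.trans ?_
    rw [div_div, div_le_div_iff₀ (by positivity) (by positivity)]
    have hdneg : 0 < -d := by
      by_contra hcon
      have : a ^ 2 * -d ≤ 0 := mul_nonpos_of_nonneg_of_nonpos (by positivity) (by linarith)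
      linarith
    have h6 : C ≤ 2 * β * n * a ^ 2 := by
      refine le_of_mul_le_mul_right ?_ hdneg
      nlinarith [mul_pos hβ hn]
    have h7 : 0 ≤ n * a ^ 2 := by positivity
    nlinarith [mul_le_mul_of_nonneg_right h6 h7]

lemma sq_integral_le [IsProbabilityMeasure μ] (h1 : Integrable Y μ)
    (h2 : Integrable (fun ω => Y ω ^ 2) μ) : (∫ ω, Y ω ∂μ) ^ 2 ≤ ∫ ω, Y ω ^ 2 ∂μ := by
  set m := ∫ ω, Y ω ∂μ with hm
  have h : 0 ≤ ∫ ω, (Y ω ^ 2 - 2 * m * Y ω + m ^ 2) ∂μ :=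
    integral_nonneg fun ω => by
      have := sq_nonneg (Y ω - m)
      show 0 ≤ _
      linarith
  rw [integral_add (by fun_prop) (by fun_prop), integral_sub (by fun_prop) (by fun_prop),
    integral_const_mul, ← hm] at h
  simp only [integral_const, probReal_univ, one_smul] at h
  linarith

/-- A lower bound for the first absolute moment in terms of the second and the fourth. -/
lemma cube_le_sq_integral_abs (h1 : Integrable Y μ)
    (h2 : Integrable (fun ω => Y ω ^ 2) μ) (h4 : Integrable (fun ω => Y ω ^ 4) μ)
    {V F : ℝ} (hV0 : 0 < V) (hF0 : 0 < F) (hV : ∫ ω, Y ω ^ 2 ∂μ = V)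
    (hF : ∫ ω, Y ω ^ 4 ∂μ ≤ F) : V ^ 3 / (8 * F) ≤ (∫ ω, |Y ω| ∂μ) ^ 2 := by
  set l := √(2 * F / V) with hl
  have hl0 : 0 < l := Real.sqrt_pos.2 (by positivity)
  have hl2 : l ^ 2 = 2 * F / V := Real.sq_sqrt (by positivity)
  have hp : ∀ ω, Y ω ^ 2 ≤ l * |Y ω| + (l ^ 2)⁻¹ * Y ω ^ 4 := fun ω => by
    rw [← sq_abs, show Y ω ^ 4 = |Y ω| ^ 4 by rw [← Even.pow_abs (by decide)]]
    have hy := abs_nonneg (Y ω)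
    generalize |Y ω| = y at hy ⊢
    rcases le_or_gt y l with h | h
    · have : 0 ≤ (l ^ 2)⁻¹ * y ^ 4 := by positivity
      nlinarith
    · have h3 : y ^ 2 ≤ (l ^ 2)⁻¹ * y ^ 4 := by
        rw [inv_mul_eq_div, le_div_iff₀ (by positivity)]
        have : l ^ 2 ≤ y ^ 2 := by gcongr
        nlinarith [sq_nonneg y]
      have : 0 ≤ l * y := by positivity
      linarith
  have hi := integral_mono h2 ((h1.abs.const_mul l).add (h4.const_mul (l ^ 2)⁻¹)) hp
  simp only [Pi.add_apply] at hi
  rw [integral_add (h1.abs.const_mul l) (h4.const_mul _), integral_const_mul,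
    integral_const_mul, hV] at hi
  have h5 : (l ^ 2)⁻¹ * ∫ ω, Y ω ^ 4 ∂μ ≤ V / 2 := by
    calc _ ≤ (l ^ 2)⁻¹ * F := by gcongr
      _ = V / 2 := by rw [hl2]; field_simp
  have h6 : V / 2 ≤ l * ∫ ω, |Y ω| ∂μ := by linarith
  have h7 : (V / 2) ^ 2 ≤ (l * ∫ ω, |Y ω| ∂μ) ^ 2 := by gcongr
  rw [mul_pow, hl2] at h7
  rw [div_le_iff₀ (by positivity)]
  have h8 : (V / 2) ^ 2 * (4 * V) ≤ 2 * F / V * (∫ ω, |Y ω| ∂μ) ^ 2 * (4 * V) := by gcongr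
  have e : 2 * F / V * (∫ ω, |Y ω| ∂μ) ^ 2 * (4 * V) = (∫ ω, |Y ω| ∂μ) ^ 2 * (8 * F) := by
    field_simp; ring
  rw [e] at h8
  refine le_trans (le_of_eq ?_) h8
  ring

lemma integral_le_mul_of_le_smul {α : ℝ} (hα : 0 ≤ α) (hle : κ ≤ ENNReal.ofReal α • μ)
    {g : Ω → ℝ} (hg : ∀ ω, 0 ≤ g ω) (hi : Integrable g μ) :
    ∫ ω, g ω ∂κ ≤ α * ∫ ω, g ω ∂μ := by
  have h := integral_mono_measure hle (ae_of_all _ hg) (hi.smul_measure ENNReal.ofReal_ne_top)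
  rwa [integral_smul_measure, ENNReal.toReal_ofReal hα, smul_eq_mul] at h

/-- The mean of the positive part under a law `κ ≤ α μ`. The second moment of `Y` under `μ` is
split between the positive and the negative part, and the share of the negative part is at least
of order `1/n`, which makes up for the difference of `2β/(n + d)` and `2β/n`. -/
lemma integral_posPart_le [IsProbabilityMeasure μ] [IsProbabilityMeasure κ] {α : ℝ}
    (hα : 0 ≤ α) (hle : κ ≤ ENNReal.ofReal α • μ) (h1 : Integrable Y μ)
    (h2 : Integrable (fun ω => Y ω ^ 2) μ) (h4 : Integrable (fun ω => Y ω ^ 4) μ)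
    (h0 : ∫ ω, Y ω ∂μ = 0) {n d β C : ℝ} (hn : 0 < n) (hd : 0 < n + d) (hd' : d ≤ n)
    (hβ : 0 < β) (hC0 : 0 < C)
    (hV : ∫ ω, Y ω ^ 2 ∂μ = 2 * β / (n + d)) (hF : ∫ ω, Y ω ^ 4 ∂μ ≤ C / n ^ 2)
    (hC : 64 * C * -d ≤ β ^ 2 * (n + d)) :
    ∫ ω, max (Y ω) 0 ∂κ ≤ √(2 * α * β / n) := by
  have hsq : ∀ ω, max (Y ω) 0 ^ 2 + max (-Y ω) 0 ^ 2 = Y ω ^ 2 := fun ω => by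
    rcases le_total (Y ω) 0 with h | h
    · simp [h]
    · simp [h]
  have hsub : ∀ ω, max (Y ω) 0 - max (-Y ω) 0 = Y ω := fun ω => by
    rcases le_total (Y ω) 0 with h | h
    · simp [h]
    · simp [h]
  have habs : ∀ ω, max (Y ω) 0 + max (-Y ω) 0 = |Y ω| := fun ω => by
    rcases le_total (Y ω) 0 with h | h
    · simp [h, abs_of_nonpos]
    · simp [h, abs_of_nonneg]
  have hp : Integrable (fun ω => max (Y ω) 0) μ := h1.pos_part
  have hm : Integrable (fun ω => max (-Y ω) 0) μ := h1.neg_part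
  have hp2 : Integrable (fun ω => max (Y ω) 0 ^ 2) μ :=
    h2.mono' (hp.aestronglyMeasurable.pow 2) (ae_of_all _ fun ω => by
      rw [Real.norm_of_nonneg (sq_nonneg _)]
      linarith [hsq ω, sq_nonneg (max (-Y ω) 0)])
  have hm2 : Integrable (fun ω => max (-Y ω) 0 ^ 2) μ :=
    h2.mono' (hm.aestronglyMeasurable.pow 2) (ae_of_all _ fun ω => by
      rw [Real.norm_of_nonneg (sq_nonneg _)]
      linarith [hsq ω, sq_nonneg (max (Y ω) 0)])
  have i1 : ∫ ω, max (Y ω) 0 ∂μ - ∫ ω, max (-Y ω) 0 ∂μ = 0 := by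
    rw [← integral_sub hp hm]; simp_rw [hsub]; exact h0
  have i2 : ∫ ω, max (Y ω) 0 ∂μ + ∫ ω, max (-Y ω) 0 ∂μ = ∫ ω, |Y ω| ∂μ := by
    rw [← integral_add hp hm]; simp_rw [habs]
  have i3 : ∫ ω, max (Y ω) 0 ^ 2 ∂μ + ∫ ω, max (-Y ω) 0 ^ 2 ∂μ = 2 * β / (n + d) := by
    rw [← integral_add hp2 hm2]; simp_rw [hsq]; exact hV
  have hlow := cube_le_sq_integral_abs h1 h2 h4 (V := 2 * β / (n + d)) (F := C / n ^ 2)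
    (by positivity) (by positivity) hV hF
  have hneg := sq_integral_le hm hm2
  -- the lower bound for the negative part
  have hkey : 2 * β / (n + d) - ∫ ω, max (-Y ω) 0 ^ 2 ∂μ ≤ 2 * β / n := by
    have e1 : ∫ ω, |Y ω| ∂μ = 2 * ∫ ω, max (-Y ω) 0 ∂μ := by linarith
    rw [e1] at hlow
    have h5 : β ^ 3 / (32 * C * n) ≤ (2 * β / (n + d)) ^ 3 / (8 * (C / n ^ 2)) / 4 := by
      have h6 : β / n ≤ 2 * β / (n + d) := by
        rw [div_le_div_iff₀ hn hd]; nlinarith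
      calc β ^ 3 / (32 * C * n) = (β / n) ^ 3 / (8 * (C / n ^ 2)) / 4 := by
            field_simp; ring
        _ ≤ _ := by gcongr
    have h7 : 2 * β / (n + d) - 2 * β / n ≤ β ^ 3 / (32 * C * n) := by
      rw [div_sub_div _ _ hd.ne' hn.ne', div_le_div_iff₀ (by positivity) (by positivity)]
      nlinarith [mul_le_mul_of_nonneg_left hC (by positivity : 0 ≤ β * n)]
    have h8 : (2 * ∫ ω, max (-Y ω) 0 ∂μ) ^ 2 / 4 = (∫ ω, max (-Y ω) 0 ∂μ) ^ 2 := by ring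
    linarith
  have hκ := hp.of_measure_le_smul ENNReal.ofReal_ne_top hle
  have hκ2 := hp2.of_measure_le_smul ENNReal.ofReal_ne_top hle
  refine Real.le_sqrt_of_sq_le ?_
  calc (∫ ω, max (Y ω) 0 ∂κ) ^ 2 ≤ ∫ ω, max (Y ω) 0 ^ 2 ∂κ := sq_integral_le hκ hκ2
    _ ≤ α * ∫ ω, max (Y ω) 0 ^ 2 ∂μ :=
      integral_le_mul_of_le_smul hα hle (fun ω => sq_nonneg _) hp2
    _ ≤ α * (2 * β / n) := by gcongr; linarith
    _ = 2 * α * β / n := by ring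

end Probability

/-- The second and fourth central moments of the base law for large `n`; the bound `4 c < ν` is what
makes the fourth moment finite. -/
lemma eventually_moments (m : ℤ) (c : ℕ) {x : ℝ} (hx : 0 < x) :
    ∃ C : ℝ, 0 < C ∧ ∀ᶠ n : ℕ in atTop, 4 * c < (n : ℝ) + m * c ∧
      ∫ t, (t - x) ^ 2 ∂baseLaw ((n : ℝ) + m * c) c x =
        2 * (x * (1 + c * x)) / (n + (m - 1) * c) ∧
      ∫ t, (t - x) ^ 4 ∂baseLaw ((n : ℝ) + m * c) c x ≤ C / (n : ℝ) ^ 2 := by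
  set A : ℝ := 24 * x + (24 + 108 * c) * x ^ 2 + (48 + 168 * c) * c * x ^ 3 +
        (24 + 84 * c) * c ^ 2 * x ^ 4 with hA
  refine ⟨8 * A, by positivity, ?_⟩
  have hlim : Tendsto (fun n : ℕ => (n : ℝ)) atTop atTop := tendsto_natCast_atTop_atTop
  filter_upwards [hlim.eventually_gt_atTop (4 * c - m * c),
    hlim.eventually_ge_atTop (2 * (3 * c - m * c)), hlim.eventually_ge_atTop (m * c),
    hlim.eventually_ge_atTop 1] with n g1 g2 g3 g4
  have hc : (0 : ℝ) ≤ c := by positivity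
  set ν : ℝ := n + m * c with hν
  have hν4 : 4 * c < ν := by linarith
  have hν0 : 0 < ν := by linarith
  refine ⟨hν4, ?_, ?_⟩
  · rw [integral_sub_sq_baseLaw hν0 (by linarith) hx.le,
      show ν - c = n + (m - 1) * c by rw [hν]; ring]
  · rw [integral_sub_fourth_baseLaw hν0 hν4 hx.le]
    have hn : (0 : ℝ) < n := by linarith
    have k1 : (n : ℝ) / 2 ≤ ν - 3 * c := by linarith
    have k2 : (n : ℝ) / 2 ≤ ν - 2 * c := by linarith
    have k3 : (n : ℝ) / 2 ≤ ν - c := by linarith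
    have k4 : ν ≤ 2 * n := by linarith
    have k5 : (c : ℝ) ≤ c * n := le_mul_of_one_le_right hc g4
    have k6 : 24 * x ≤ 24 * x * n := le_mul_of_one_le_right (by positivity) g4
    have num : 24 * x + (12 * ν + 108 * c) * x ^ 2 + (24 * ν + 168 * c) * c * x ^ 3 +
        (12 * ν + 84 * c) * c ^ 2 * x ^ 4 ≤ A * n := by
      calc _ ≤ 24 * x * n + (12 * (2 * n) + 108 * (c * n)) * x ^ 2 +
            (24 * (2 * n) + 168 * (c * n)) * c * x ^ 3 +
            (12 * (2 * n) + 84 * (c * n)) * c ^ 2 * x ^ 4 := by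
            gcongr
        _ = A * n := by rw [hA]; ring
    have k7 : 0 ≤ ν - c := by linarith
    have k8 : 0 ≤ ν - 2 * c := by linarith
    have h3 : (n : ℝ) ^ 3 / 8 ≤ (ν - c) * (ν - 2 * c) * (ν - 3 * c) := by
      calc (n : ℝ) ^ 3 / 8 = n / 2 * (n / 2) * (n / 2) := by ring
        _ ≤ _ := by gcongr
    calc _ ≤ A * n / ((n : ℝ) ^ 3 / 8) :=
          div_le_div₀ (by positivity) num (by positivity) h3
      _ = 8 * A / (n : ℝ) ^ 2 := by field_simp

/-- For large `n`, the tails of the base law obey Chebyshev's inequality with the limiting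
variance, and the mean absolute deviations to either side under the Bézier law are at most
`√(2αx(1+cx)/n)`. -/
lemma eventually_tail_and_deviation (m : ℤ) (c : ℕ) {α x : ℝ} (hα : 1 ≤ α) (hx : 0 < x) :
    ∀ᶠ n : ℕ in atTop,
      (∀ a : ℝ, 0 < a → (bezierLaw ((n : ℝ) + m * c) c α x).real {t | a ≤ t - x} ≤
        2 * α * (x * (1 + c * x)) / (n * a ^ 2)) ∧
      (∀ a : ℝ, 0 < a → (bezierLaw ((n : ℝ) + m * c) c α x).real {t | a ≤ x - t} ≤
        2 * α * (x * (1 + c * x)) / (n * a ^ 2)) ∧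
      ∫ t, max (t - x) 0 ∂bezierLaw ((n : ℝ) + m * c) c α x ≤
        √(2 * α * (x * (1 + c * x)) / n) ∧
      ∫ t, max (x - t) 0 ∂bezierLaw ((n : ℝ) + m * c) c α x ≤
        √(2 * α * (x * (1 + c * x)) / n) := by
  obtain ⟨C, hC, hmom⟩ := eventually_moments m c hx
  have hlim : Tendsto (fun n : ℕ => (n : ℝ)) atTop atTop := tendsto_natCast_atTop_atTop
  set β : ℝ := x * (1 + c * x) with hβdef
  have hβ : 0 < β := by positivity
  set d : ℝ := (m - 1) * c with hd
  filter_upwards [hmom, hlim.eventually_gt_atTop 0, hlim.eventually_gt_atTop (-d),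
    hlim.eventually_ge_atTop d, hlim.eventually_ge_atTop (C * -d / (4 * β ^ 2)),
    hlim.eventually_ge_atTop (64 * C * -d / β ^ 2 - d)] with n ⟨hν4, hV, hF⟩ hn hnd hdn hn1 hn2
  set ν : ℝ := n + m * c with hν
  have hc : (0 : ℝ) ≤ c := by positivity
  have hν0 : 0 < ν := by linarith
  have := isProbabilityMeasure_baseLaw (c := c) hν0 hx.le
  have := isProbabilityMeasure_bezierLaw (c := c) hν0 hx.le hα
  have hle := bezierLaw_le (c := c) hν0 hx.le hα
  have hi : ∀ N : ℕ, N ≤ 4 → Integrable (fun t => (t - x) ^ N) (baseLaw ν c x) := fun N hN => by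
    refine integrable_sub_pow_baseLaw N hν0 ?_ hx.le
    have : (N : ℝ) * c ≤ 4 * c := by gcongr; exact_mod_cast hN
    linarith
  have hi1 : Integrable (fun t => t - x) (baseLaw ν c x) := by simpa using hi 1 (by simp)
  have hi2 := hi 2 (by simp)
  have hi4 := hi 4 le_rfl
  have h0 : ∫ t, (t - x) ∂baseLaw ν c x = 0 := integral_sub_baseLaw hν0 (by linarith) hx.le
  -- the same facts for `x - T`
  have hi1' : Integrable (fun t => x - t) (baseLaw ν c x) := by
    refine hi1.neg.congr (ae_of_all _ fun t => ?_)
    simp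
  have e2 : ∀ t : ℝ, (x - t) ^ 2 = (t - x) ^ 2 := fun t => by ring
  have e4 : ∀ t : ℝ, (x - t) ^ 4 = (t - x) ^ 4 := fun t => by ring
  have hi2' : Integrable (fun t => (x - t) ^ 2) (baseLaw ν c x) := by simpa only [e2] using hi2
  have hi4' : Integrable (fun t => (x - t) ^ 4) (baseLaw ν c x) := by simpa only [e4] using hi4
  have h0' : ∫ t, (x - t) ∂baseLaw ν c x = 0 := by
    have := integral_neg (μ := baseLaw ν c x) fun t => t - x
    simpa [h0] using this
  have hV' : ∫ t, (x - t) ^ 2 ∂baseLaw ν c x = 2 * β / (n + d) := by simp_rw [e2]; exact hV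
  have hF' : ∫ t, (x - t) ^ 4 ∂baseLaw ν c x ≤ C / (n : ℝ) ^ 2 := by simp_rw [e4]; exact hF
  have hnd' : 0 < (n : ℝ) + d := by linarith
  have hC1 : C * -d ≤ 4 * β ^ 2 * n := by
    rw [div_le_iff₀ (by positivity)] at hn1; linarith
  have hC2 : 64 * C * -d ≤ β ^ 2 * (n + d) := by
    have : 64 * C * -d / β ^ 2 ≤ n + d := by linarith
    rw [div_le_iff₀ (by positivity)] at this; linarith
  have hreal : ∀ s : Set ℝ, (bezierLaw ν c α x).real s ≤ α * (baseLaw ν c x).real s := fun s => by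
    have h := hle s
    rw [Measure.smul_apply, smul_eq_mul] at h
    have h' := ENNReal.toReal_mono (by finiteness) h
    rwa [ENNReal.toReal_mul, ENNReal.toReal_ofReal (by linarith)] at h'
  refine ⟨fun a ha => ?_, fun a ha => ?_, ?_, ?_⟩
  · refine (hreal _).trans ?_
    have := meas_ge_le_of_moments hi1 hi2 hi4 h0 hn hnd' hβ hV hF hC1 ha
    calc _ ≤ α * (2 * β / (n * a ^ 2)) := by gcongr
      _ = _ := by ring
  · refine (hreal _).trans ?_
    have := meas_ge_le_of_moments hi1' hi2' hi4' h0' hn hnd' hβ hV' hF' hC1 ha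
    calc _ ≤ α * (2 * β / (n * a ^ 2)) := by gcongr
      _ = _ := by ring
  · exact integral_posPart_le (by linarith) hle hi1 hi2 hi4 h0 hn hnd' hdn hβ hC hV hF hC2
  · exact integral_posPart_le (by linarith) hle hi1' hi2' hi4' h0' hn hnd' hdn hβ hC hV' hF' hC2

/-! ### Functions of bounded variation -/

lemma boundedVariationOn_add {u v : ℝ → ℝ} {s : Set ℝ} (hu : BoundedVariationOn u s)
    (hv : BoundedVariationOn v s) : BoundedVariationOn (fun t => u t + v t) s := by
  refine ne_top_of_le_ne_top (ENNReal.add_ne_top.2 ⟨hu, hv⟩) (iSup_le fun p => ?_)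
  calc _ ≤ ∑ i ∈ Finset.range p.1, (edist (u (p.2.1 (i + 1))) (u (p.2.1 i)) +
        edist (v (p.2.1 (i + 1))) (v (p.2.1 i))) :=
        Finset.sum_le_sum fun i _ => edist_add_add_le _ _ _ _
    _ ≤ _ := by
        rw [Finset.sum_add_distrib]
        exact add_le_add (eVariationOn.sum_le p.2.2.1 p.2.2.2)
          (eVariationOn.sum_le p.2.2.1 p.2.2.2)

lemma boundedVariationOn_const_mul {u : ℝ → ℝ} {s : Set ℝ} (k : ℝ)
    (hu : BoundedVariationOn u s) : BoundedVariationOn (fun t => k * u t) s :=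
  (lipschitzWith_smul k).comp_boundedVariationOn hu

lemma boundedVariationOn_Icc_of_monotone {u : ℝ → ℝ} (hu : Monotone u) (a b : ℝ) :
    BoundedVariationOn u (Icc a b) := by
  rcases le_or_gt a b with h | h
  · have := (hu.monotoneOn (Icc a b)).locallyBoundedVariationOn a b ⟨le_rfl, h⟩ ⟨h, le_rfl⟩
    rwa [inter_self] at this
  · rw [Icc_eq_empty h.not_ge]
    exact BoundedVariationOn.of_subsingleton subsingleton_empty

/-- `auxFun g x` differs from `g` by a step function, hence has bounded variation too. -/
lemma boundedVariationOn_auxFun {g : ℝ → ℝ} (hg : LocallyBoundedVariationOn g (Ici 0)) (x : ℝ)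
    {a b : ℝ} (ha : 0 ≤ a) : BoundedVariationOn (auxFun g x) (Icc a b) := by
  rcases lt_or_ge b a with hab | hab
  · rw [Icc_eq_empty hab.not_ge]
    exact BoundedVariationOn.of_subsingleton subsingleton_empty
  have h0 : BoundedVariationOn g (Icc a b) :=
    (hg a b ha (ha.trans hab)).mono fun t ht => ⟨ha.trans ht.1, ht⟩
  have h1 : BoundedVariationOn (fun t => if x ≤ t then (1 : ℝ) else 0) (Icc a b) := by
    refine boundedVariationOn_Icc_of_monotone (fun s t hst => ?_) a b
    split_ifs <;> linarith
  have h2 : BoundedVariationOn (fun t => if x < t then (1 : ℝ) else 0) (Icc a b) := by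
    refine boundedVariationOn_Icc_of_monotone (fun s t hst => ?_) a b
    split_ifs <;> linarith
  have h3 : BoundedVariationOn (fun _ : ℝ => -Function.leftLim g x) (Icc a b) :=
    boundedVariationOn_Icc_of_monotone monotone_const a b
  have h := boundedVariationOn_add (boundedVariationOn_add (boundedVariationOn_add h0 h3)
    (boundedVariationOn_const_mul (Function.leftLim g x - g x) h1))
    (boundedVariationOn_const_mul (g x - Function.rightLim g x) h2)
  convert h using 1
  ext t
  rcases lt_trichotomy t x with ht | rfl | ht
  · simp [auxFun, ht, ht.not_gt, ht.not_ge]; ring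
  · simp [auxFun]; ring
  · simp [auxFun, ht, ht.not_gt, ht.le, ht.ne']; ring

lemma totalVar_mono {h : ℝ → ℝ} {a b a' b' : ℝ} (hb : BoundedVariationOn h (Icc a' b'))
    (ha : a' ≤ a) (hb' : b ≤ b') : totalVar h a b ≤ totalVar h a' b' :=
  ENNReal.toReal_mono hb (eVariationOn.mono _ (Icc_subset_Icc ha hb'))

lemma totalVar_nonneg (h : ℝ → ℝ) (a b : ℝ) : 0 ≤ totalVar h a b := ENNReal.toReal_nonneg

lemma auxFun_self (g : ℝ → ℝ) (x : ℝ) : auxFun g x x = 0 := by simp [auxFun]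

/-- The variation of `auxFun g x` on `[x, x + s]`, as a function of `s`. -/
noncomputable def rightVar (g : ℝ → ℝ) (x s : ℝ) : ℝ := totalVar (auxFun g x) x (x + s)

/-- The variation of `auxFun g x` on `[x - s, x]`, as a function of `s`; the interval is cut off
at `0`, to the left of which nothing is assumed of `g`. -/
noncomputable def leftVar (g : ℝ → ℝ) (x s : ℝ) : ℝ := totalVar (auxFun g x) (max (x - s) 0) x

section Variation

variable {g : ℝ → ℝ} {x : ℝ}

lemma monotone_rightVar (hg : LocallyBoundedVariationOn g (Ici 0)) (hx : 0 ≤ x) :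
    Monotone (rightVar g x) := fun s t hst =>
  totalVar_mono (boundedVariationOn_auxFun hg x hx) le_rfl (by linarith)

lemma monotone_leftVar (hg : LocallyBoundedVariationOn g (Ici 0)) :
    Monotone (leftVar g x) := fun s t hst =>
  totalVar_mono (boundedVariationOn_auxFun hg x (le_max_right _ _))
    (max_le_max (by linarith) le_rfl) le_rfl

lemma abs_auxFun_le_rightVar (hg : LocallyBoundedVariationOn g (Ici 0)) (hx : 0 ≤ x) {u : ℝ}
    (hu : x ≤ u) : |auxFun g x u| ≤ rightVar g x (u - x) := by
  have h := (boundedVariationOn_auxFun hg x hx (b := u)).dist_le (x := u) (y := x)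
    ⟨hu, le_rfl⟩ ⟨le_rfl, hu⟩
  rw [auxFun_self, dist_zero_right, Real.norm_eq_abs] at h
  rwa [rightVar, add_sub_cancel]

lemma abs_auxFun_le_leftVar (hg : LocallyBoundedVariationOn g (Ici 0)) {u : ℝ} (hu : 0 ≤ u)
    (hux : u ≤ x) : |auxFun g x u| ≤ leftVar g x (x - u) := by
  have h := (boundedVariationOn_auxFun hg x hu (b := x)).dist_le (x := u) (y := x)
    ⟨le_rfl, hux⟩ ⟨hux, le_rfl⟩
  rw [auxFun_self, dist_zero_right, Real.norm_eq_abs] at h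
  rwa [leftVar, sub_sub_cancel, max_eq_left hu]

end Variation

section DBV

variable {f g : ℝ → ℝ}

lemma IsDBV.continuousOn (hf : IsDBV f g) : ContinuousOn f (Ici 0) := by
  refine continuousOn_of_locally_continuousOn fun t ht => ⟨Iio (t + 1), isOpen_Iio,
    lt_add_one t, ?_⟩
  have ht' : 0 ≤ t + 1 := by have := mem_Ici.1 ht; linarith
  refine (hf.absolutelyContinuous (t + 1) ht').continuousOn.mono fun s hs => ?_
  rw [uIcc_of_le ht']
  exact ⟨hs.1, le_of_lt hs.2⟩

/-- The fundamental theorem of calculus, with the representative `g` of the derivative. -/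
lemma IsDBV.integral_eq_sub (hf : IsDBV f g) {a b : ℝ} (ha : 0 ≤ a) (hab : a ≤ b) :
    IntervalIntegrable g volume a b ∧ ∫ t in a..b, g t = f b - f a := by
  have hac : AbsolutelyContinuousOnInterval f a b := by
    refine (hf.absolutelyContinuous b (ha.trans hab)).mono ?_
    rw [uIcc_of_le hab, uIcc_of_le (ha.trans hab)]
    exact Icc_subset_Icc_left ha
  have hae : ∀ᵐ t, t ∈ uIoc a b → deriv f t = g t := by
    filter_upwards [(ae_restrict_iff' measurableSet_Ioi).1 hf.hasDerivAt_ae] with t ht hmem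
    rw [uIoc_of_le hab] at hmem
    exact (ht (lt_of_le_of_lt ha hmem.1)).deriv
  refine ⟨hac.intervalIntegrable_deriv.congr_ae ((ae_restrict_iff' measurableSet_uIoc).2 hae), ?_⟩
  rw [← hac.integral_deriv_eq_sub]
  exact (intervalIntegral.integral_congr_ae hae).symm

/-- To the right of `x`, `f` is affine with slope `g(x+)` up to the primitive of the variation. -/
lemma IsDBV.abs_sub_sub_le_right (hf : IsDBV f g) {x t : ℝ} (hx : 0 ≤ x) (hxt : x ≤ t) :
    |f t - f x - Function.rightLim g x * (t - x)| ≤ ∫ s in (0 : ℝ)..(t - x), rightVar g x s := by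
  obtain ⟨hi, he⟩ := hf.integral_eq_sub hx hxt
  have h1 : f t - f x - Function.rightLim g x * (t - x) =
      ∫ u in x..t, (g u - Function.rightLim g x) := by
    rw [intervalIntegral.integral_sub hi intervalIntegrable_const, he]
    simp [mul_comm]
  have h2 : ∫ u in x..t, rightVar g x (u - x) = ∫ s in (0 : ℝ)..(t - x), rightVar g x s := by
    rw [intervalIntegral.integral_comp_sub_right (fun s => rightVar g x s) x, sub_self]
  have hmono := monotone_rightVar hf.boundedVariation hx
  rw [h1, ← h2, ← Real.norm_eq_abs]
  refine intervalIntegral.norm_integral_le_of_norm_le hxt (ae_of_all _ fun u hu => ?_)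
    (Monotone.intervalIntegrable fun a b hab => hmono (by linarith))
  have h3 := abs_auxFun_le_rightVar hf.boundedVariation hx hu.1.le
  rwa [auxFun, if_neg hu.1.not_gt, if_neg hu.1.ne'] at h3

/-- To the left of `x`, `f` is affine with slope `g(x-)` up to the primitive of the variation. -/
lemma IsDBV.abs_sub_sub_le_left (hf : IsDBV f g) {x t : ℝ} (ht : 0 ≤ t) (htx : t ≤ x) :
    |f t - f x + Function.leftLim g x * (x - t)| ≤ ∫ s in (0 : ℝ)..(x - t), leftVar g x s := by
  obtain ⟨hi, he⟩ := hf.integral_eq_sub ht htx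
  have h1 : f t - f x + Function.leftLim g x * (x - t) =
      -∫ u in t..x, (g u - Function.leftLim g x) := by
    rw [intervalIntegral.integral_sub hi intervalIntegrable_const, he]
    simp
    ring
  have h2 : ∫ u in t..x, leftVar g x (x - u) = ∫ s in (0 : ℝ)..(x - t), leftVar g x s := by
    rw [intervalIntegral.integral_comp_sub_left (fun s => leftVar g x s) x, sub_self]
  have hmono : Monotone (leftVar g x) := monotone_leftVar hf.boundedVariation
  rw [h1, ← h2, abs_neg, ← Real.norm_eq_abs]
  refine intervalIntegral.norm_integral_le_of_norm_le htx ?_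
    (Antitone.intervalIntegrable fun a b hab => hmono (by linarith))
  have hne : ∀ᵐ u : ℝ, u ≠ x := by simp [ae_iff]
  filter_upwards [hne] with u hux hu
  have hlt : u < x := lt_of_le_of_ne hu.2 hux
  have h3 := abs_auxFun_le_leftVar hf.boundedVariation (ht.trans hu.1.le) hu.2
  rwa [auxFun, if_pos hlt] at h3

end DBV

/-! ### Integrals of primitives against a law with Chebyshev tails -/

lemma integral_inv_sq {a b : ℝ} (ha : 0 < a) (hab : a ≤ b) :
    IntervalIntegrable (fun s : ℝ => (s ^ 2)⁻¹) volume a b ∧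
      ∫ s in a..b, (s ^ 2)⁻¹ = a⁻¹ - b⁻¹ := by
  have hpos : ∀ s ∈ uIcc a b, s ≠ 0 := fun s hs => by
    rw [uIcc_of_le hab] at hs; exact (ha.trans_le hs.1).ne'
  have hi : IntervalIntegrable (fun s : ℝ => (s ^ 2)⁻¹) volume a b :=
    ContinuousOn.intervalIntegrable fun s hs => by
      have := hpos s hs
      exact ContinuousAt.continuousWithinAt (by fun_prop (disch := positivity))
  refine ⟨hi, ?_⟩
  rw [intervalIntegral.integral_eq_sub_of_hasDerivAt (f := fun s => -s⁻¹)
    (fun s hs => (hasDerivAt_inv (hpos s hs)).neg.congr_deriv (neg_neg _)) hi]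
  ring

lemma intervalIntegrable_monotone_mul_inv_sq {v : ℝ → ℝ} (hv : Monotone v) {a b : ℝ} (ha : 0 < a)
    (hab : a ≤ b) : IntervalIntegrable (fun s => v s * (s ^ 2)⁻¹) volume a b := by
  refine (hv.intervalIntegrable).mul_continuousOn fun s hs => ?_
  rw [uIcc_of_le hab] at hs
  have : s ≠ 0 := (ha.trans_le hs.1).ne'
  exact ContinuousAt.continuousWithinAt (by fun_prop (disch := positivity))

/-- In terms of `w = x / s` this compares the integral of `v (x / w)` over `[1, K + 1]` with its
upper Riemann sum. -/
lemma integral_monotone_div_sq_le {v : ℝ → ℝ} (hv : Monotone v) {x : ℝ} (hx : 0 < x) (K : ℕ) :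
    ∫ s in (x / ((K : ℝ) + 1))..x, v s * (s ^ 2)⁻¹ ≤
      1 / x * ∑ k ∈ Finset.Icc 1 K, v (x / k) := by
  induction K with
  | zero => simp
  | succ K ih =>
    have h1 : 0 < x / ((K : ℝ) + 1 + 1) := by positivity
    have h2 : x / ((K : ℝ) + 1 + 1) ≤ x / ((K : ℝ) + 1) := by gcongr; linarith
    have h3 : x / ((K : ℝ) + 1) ≤ x := div_le_self hx.le (by
      have : (0 : ℝ) ≤ K := by positivity
      linarith)
    push_cast
    rw [← intervalIntegral.integral_add_adjacent_intervals
      (intervalIntegrable_monotone_mul_inv_sq hv h1 h2)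
      (intervalIntegrable_monotone_mul_inv_sq hv (h1.trans_le h2) h3),
      Finset.sum_Icc_succ_top (by lia), mul_add, add_comm]
    refine add_le_add ih ?_
    obtain ⟨hi, he⟩ := integral_inv_sq h1 h2
    calc _ ≤ ∫ s in (x / ((K : ℝ) + 1 + 1))..(x / ((K : ℝ) + 1)),
          v (x / ((K : ℝ) + 1)) * (s ^ 2)⁻¹ := by
          refine intervalIntegral.integral_mono_on h2
            (intervalIntegrable_monotone_mul_inv_sq hv h1 h2) (hi.const_mul _) fun s hs => ?_
          have := hv hs.2
          gcongr
      _ = _ := by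
          rw [intervalIntegral.integral_const_mul, he]
          push_cast
          field_simp
          ring

/-- If the upper tail of `Y` obeys a Chebyshev bound, the mean of the primitive of a monotone
function `v` at `Y`, clipped to `[0,x]`, is controlled by the values of `v` at `x / k`. By the
layer cake formula it is `∫ P(Y ≥ s) v(s) ds`; the probability is estimated by `1` below
`x / √n` and by Chebyshev's bound above. -/
lemma integral_primitive_le {Ω : Type*} [MeasurableSpace Ω] {κ : Measure Ω}
    [IsProbabilityMeasure κ] {Y : Ω → ℝ} (hY : Measurable Y) {v : ℝ → ℝ} (hv : Monotone v)
    (hv0 : ∀ s, 0 ≤ v s) {x D : ℝ} (hx : 0 < x) (hD : 0 ≤ D) {n : ℕ} (hn : 0 < n)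
    (htail : ∀ a : ℝ, 0 < a → κ.real {ω | a ≤ Y ω} ≤ D / (n * a ^ 2)) :
    Integrable (fun ω => ∫ s in (0 : ℝ)..min (max (Y ω) 0) x, v s) κ ∧
      ∫ ω, (∫ s in (0 : ℝ)..min (max (Y ω) 0) x, v s) ∂κ ≤
        D / (n * x) * ∑ k ∈ Finset.Icc 1 ⌊√(n : ℝ)⌋₊, v (x / k) +
          x / √(n : ℝ) * v (x / √(n : ℝ)) := by
  have hvi : ∀ a b : ℝ, IntervalIntegrable v volume a b := fun a b => hv.intervalIntegrable
  set Z : Ω → ℝ := fun ω => min (max (Y ω) 0) x with hZ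
  have hZm : Measurable Z := (hY.max measurable_const).min measurable_const
  have hZ0 : ∀ ω, 0 ≤ Z ω := fun ω => le_min (le_max_right _ _) hx.le
  have hZx : ∀ ω, Z ω ≤ x := fun ω => min_le_right _ _
  have hF0 : ∀ ω, 0 ≤ ∫ s in (0 : ℝ)..Z ω, v s := fun ω =>
    intervalIntegral.integral_nonneg (hZ0 ω) fun s _ => hv0 s
  have hmeas : Measurable fun ω => ∫ s in (0 : ℝ)..Z ω, v s :=
    (intervalIntegral.continuous_primitive hvi 0).measurable.comp hZm
  have hint : Integrable (fun ω => ∫ s in (0 : ℝ)..Z ω, v s) κ := by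
    refine (integrable_const (∫ s in (0 : ℝ)..x, v s)).mono' hmeas.aestronglyMeasurable
      (ae_of_all _ fun ω => ?_)
    rw [Real.norm_of_nonneg (hF0 ω)]
    exact intervalIntegral.integral_mono_interval le_rfl (hZ0 ω) (hZx ω)
      (ae_of_all _ hv0) (hvi 0 x)
  refine ⟨hint, ?_⟩
  have hn' : (1 : ℝ) ≤ n := by exact_mod_cast hn
  have hs1 : 1 ≤ √(n : ℝ) := Real.one_le_sqrt.2 hn'
  have hs0 : 0 < √(n : ℝ) := by linarith
  set δ := x / √(n : ℝ) with hδ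
  have hδ0 : 0 < δ := by positivity
  have hδx : δ ≤ x := div_le_self hx.le hs1
  set S := ∑ k ∈ Finset.Icc 1 ⌊√(n : ℝ)⌋₊, v (x / k) with hS
  have hS0 : 0 ≤ S := Finset.sum_nonneg fun k _ => hv0 _
  have hrhs : 0 ≤ D / (n * x) * S + δ * v δ := by
    have := hv0 δ
    positivity
  have hreal : ∀ s : ℝ, κ {ω | s ≤ Z ω} = ENNReal.ofReal (κ.real {ω | s ≤ Z ω}) := fun s =>
    (ofReal_measureReal).symm
  rw [integral_eq_lintegral_of_nonneg_ae (ae_of_all _ hF0) hmeas.aestronglyMeasurable]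
  refine ENNReal.toReal_le_of_le_ofReal hrhs ?_
  rw [lintegral_comp_eq_lintegral_meas_le_mul κ (ae_of_all _ hZ0) hZm.aemeasurable
    (fun t _ => hvi 0 t) (ae_of_all _ hv0)]
  have hsplit : Ioi (0 : ℝ) = Ioc 0 δ ∪ (Ioc δ x ∪ Ioi x) := by
    rw [Ioc_union_Ioi_eq_Ioi hδx, Ioc_union_Ioi_eq_Ioi hδ0.le]
  rw [hsplit, add_comm, ENNReal.ofReal_add (by have := hv0 δ; positivity) (by positivity)]
  refine (lintegral_union_le _ _ _).trans (add_le_add ?_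
    ((lintegral_union_le _ _ _).trans ?_))
  · calc _ ≤ ∫⁻ s in Ioc 0 δ, ENNReal.ofReal (v δ) := by
          refine setLIntegral_mono' measurableSet_Ioc fun s hs => ?_
          calc _ ≤ 1 * ENNReal.ofReal (v δ) := by
                gcongr
                · exact prob_le_one
                · exact hv hs.2
            _ = _ := one_mul _
      _ = _ := by
          rw [setLIntegral_const, Real.volume_Ioc, sub_zero, mul_comm,
            ← ENNReal.ofReal_mul hδ0.le]
  · have hzero : ∫⁻ s in Ioi x, κ {a | s ≤ Z a} * ENNReal.ofReal (v s) = 0 := by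
      rw [setLIntegral_congr_fun (g := fun _ => 0) measurableSet_Ioi fun s hs => ?_]
      · simp
      · have : {a | s ≤ Z a} = ∅ := by
          ext ω
          simpa using (hZx ω).trans_lt hs
        simp [this]
    rw [hzero, add_zero]
    have hcheb : ∀ s ∈ Ioc δ x, κ {a | s ≤ Z a} * ENNReal.ofReal (v s) ≤
        ENNReal.ofReal (D / n * (v s * (s ^ 2)⁻¹)) := fun s hs => by
      have hs0 : 0 < s := hδ0.trans hs.1
      have hsub : κ.real {a | s ≤ Z a} ≤ D / (n * s ^ 2) := by
        refine (measureReal_mono fun ω hω => ?_).trans (htail s hs0)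
        have h1 : s ≤ max (Y ω) 0 := (show s ≤ Z ω from hω).trans (min_le_left _ _)
        exact (le_max_iff.1 h1).resolve_right hs0.not_ge
      rw [hreal, ← ENNReal.ofReal_mul measureReal_nonneg]
      refine ENNReal.ofReal_le_ofReal ?_
      calc _ ≤ D / (n * s ^ 2) * v s := mul_le_mul_of_nonneg_right hsub (hv0 s)
        _ = _ := by field_simp
    refine (setLIntegral_mono' measurableSet_Ioc hcheb).trans ?_
    have hi := (intervalIntegrable_monotone_mul_inv_sq hv hδ0 hδx).const_mul (D / n)
    rw [← ofReal_integral_eq_lintegral_ofReal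
      ((intervalIntegrable_iff_integrableOn_Ioc_of_le hδx).1 hi)
      (ae_of_all _ fun s => by have := hv0 s; show 0 ≤ _; positivity),
      ← intervalIntegral.integral_of_le hδx, intervalIntegral.integral_const_mul]
    refine ENNReal.ofReal_le_ofReal ?_
    have hfl : x / ((⌊√(n : ℝ)⌋₊ : ℝ) + 1) ≤ δ := by
      have := Nat.lt_floor_add_one (√(n : ℝ))
      rw [hδ]
      gcongr
    have hlo : 0 < x / ((⌊√(n : ℝ)⌋₊ : ℝ) + 1) := by positivity
    have hle : ∫ s in δ..x, v s * (s ^ 2)⁻¹ ≤ 1 / x * S :=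
      (intervalIntegral.integral_mono_interval hfl hδx le_rfl
        (ae_of_all _ fun s => by have := hv0 s; show 0 ≤ _; positivity)
        (intervalIntegrable_monotone_mul_inv_sq hv hlo (hfl.trans hδx))).trans
        (integral_monotone_div_sq_le hv hx _)
    calc _ ≤ D / n * (1 / x * S) := by gcongr
      _ = _ := by field_simp

/-! ### The estimate -/

lemma rpow_le_one_add_pow {t s : ℝ} (ht : 0 ≤ t) (hs : 0 ≤ s) {N : ℕ} (hN : s ≤ N) :
    t ^ s ≤ 1 + t ^ N := by
  rcases le_total t 1 with h | h
  · have h1 := Real.rpow_le_one ht h hs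
    have h2 : 0 ≤ t ^ N := by positivity
    linarith
  · have h1 := Real.rpow_le_rpow_of_exponent_le h hN
    rw [Real.rpow_natCast] at h1
    linarith

lemma truncPow_nonneg {x : ℝ} (hx : 0 ≤ x) (s t : ℝ) : 0 ≤ truncPow x s t := by
  refine indicator_nonneg (fun u hu => Real.rpow_nonneg ?_ s) t
  have := mem_Ioi.1 hu
  linarith

lemma measurable_truncPow (x s : ℝ) : Measurable (truncPow x s) :=
  ((measurable_id.sub_const x).pow_const s).indicator measurableSet_Ioi

lemma abs_truncPow_le {x s t : ℝ} (hx : 0 ≤ x) (hs : 0 ≤ s) (ht : 0 ≤ t) {N : ℕ} (hN : s ≤ N) :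
    |truncPow x s t| ≤ 1 * (1 + t ^ N) := by
  rw [abs_of_nonneg (truncPow_nonneg hx s t), one_mul, truncPow, indicator_apply]
  split_ifs with h
  · have h' := mem_Ioi.1 h
    exact (Real.rpow_le_rpow (by linarith) (by linarith) hs).trans (rpow_le_one_add_pow ht hs hN)
  · positivity

lemma IsDBV.exists_growth_bound {f g : ℝ → ℝ} (hf : IsDBV f g) {x M γ : ℝ} (hx : 0 ≤ x)
    (hM : 0 ≤ M) (hγ : 0 ≤ γ) (hb : ∀ t, 2 * x ≤ t → |f t| ≤ M * t ^ γ) {N : ℕ} (hN : γ ≤ N) :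
    ∃ C : ℝ, ∀ t, 0 ≤ t → |f t| ≤ C * (1 + t ^ N) := by
  obtain ⟨B, hB⟩ := isCompact_Icc.exists_bound_of_continuousOn
    (hf.continuousOn.mono fun t (ht : t ∈ Icc 0 (2 * x)) => ht.1)
  have hB0 : 0 ≤ B := (norm_nonneg _).trans (hB 0 ⟨le_rfl, by linarith⟩)
  refine ⟨B + M, fun t ht => ?_⟩
  have hp : 0 ≤ t ^ N := by positivity
  rcases le_total t (2 * x) with h | h
  · have := hB t ⟨ht, h⟩
    rw [Real.norm_eq_abs] at this
    nlinarith [mul_nonneg hB0 hp, mul_nonneg hM hp]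
  · have h1 := hb t h
    have h2 := mul_le_mul_of_nonneg_left (rpow_le_one_add_pow ht hγ hN) hM
    nlinarith [mul_nonneg hB0 hp]

/-- The pointwise estimate of the deviation. -/
lemma IsDBV.abs_sub_le {f g : ℝ → ℝ} (hf : IsDBV f g) {x M γ r : ℝ} (hx : 0 < x)
    (hM : 0 ≤ M) (hγ : 0 ≤ γ) (hr : 0 < r) (hb : ∀ t, 2 * x ≤ t → |f t| ≤ M * t ^ γ) {t : ℝ}
    (ht : 0 ≤ t) :
    |f t - f x| ≤ |Function.leftLim g x| * max (x - t) 0 +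
      |Function.rightLim g x| * max (t - x) 0 +
      (∫ s in (0 : ℝ)..min (max (x - t) 0) x, leftVar g x s) +
      (∫ s in (0 : ℝ)..min (max (t - x) 0) x, rightVar g x s) +
      M * 2 ^ γ * truncPow x (2 * r) t ^ (γ / (2 * r)) +
      |f x| * (Ici (2 * x)).indicator (fun _ => (1 : ℝ)) t := by
  set p := Function.rightLim g x
  set q := Function.leftLim g x
  have hL : ∀ y, 0 ≤ ∫ s in (0 : ℝ)..min (max y 0) x, leftVar g x s := fun y =>
    intervalIntegral.integral_nonneg (le_min (le_max_right _ _) hx.le)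
      fun s _ => totalVar_nonneg _ _ _
  have hR : ∀ y, 0 ≤ ∫ s in (0 : ℝ)..min (max y 0) x, rightVar g x s := fun y =>
    intervalIntegral.integral_nonneg (le_min (le_max_right _ _) hx.le)
      fun s _ => totalVar_nonneg _ _ _
  have hT : 0 ≤ M * 2 ^ γ * truncPow x (2 * r) t ^ (γ / (2 * r)) := by
    have := Real.rpow_nonneg (truncPow_nonneg hx.le (2 * r) t) (γ / (2 * r))
    positivity
  have hI : 0 ≤ |f x| * (Ici (2 * x)).indicator (fun _ => (1 : ℝ)) t :=
    mul_nonneg (abs_nonneg _) (indicator_nonneg (fun _ _ => zero_le_one) _)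
  have hq0 : 0 ≤ |q| * max (x - t) 0 := by positivity
  have hp0 : 0 ≤ |p| * max (t - x) 0 := by positivity
  rcases le_or_gt t x with h1 | h1
  · have h2 := hf.abs_sub_sub_le_left ht h1
    have e : min (max (x - t) 0) x = x - t := by
      rw [max_eq_left (by linarith), min_eq_left (by linarith)]
    have h3 : |f t - f x| ≤ |q| * max (x - t) 0 +
        ∫ s in (0 : ℝ)..min (max (x - t) 0) x, leftVar g x s := by
      rw [e, max_eq_left (by linarith : 0 ≤ x - t)]
      have h4 := abs_sub (f t - f x + q * (x - t)) (q * (x - t))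
      rw [add_sub_cancel_right, abs_mul, abs_of_nonneg (by linarith : 0 ≤ x - t)] at h4
      linarith
    linarith [hR (t - x)]
  rcases le_or_gt t (2 * x) with h2 | h2
  · have h3 := hf.abs_sub_sub_le_right hx.le h1.le
    have e : min (max (t - x) 0) x = t - x := by
      rw [max_eq_left (by linarith), min_eq_left (by linarith)]
    have h5 : |f t - f x| ≤ |p| * max (t - x) 0 +
        ∫ s in (0 : ℝ)..min (max (t - x) 0) x, rightVar g x s := by
      rw [e, max_eq_left (by linarith : 0 ≤ t - x)]
      have h4 := abs_add_le (f t - f x - p * (t - x)) (p * (t - x))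
      rw [sub_add_cancel, abs_mul, abs_of_nonneg (by linarith : 0 ≤ t - x)] at h4
      linarith
    linarith [hL (x - t)]
  · -- beyond `2x` one has `t ≤ 2 (t - x)`
    have h3 : |f t| ≤ M * 2 ^ γ * truncPow x (2 * r) t ^ (γ / (2 * r)) := by
      rw [truncPow, indicator_of_mem (mem_Ioi.2 h2), ← Real.rpow_mul (by linarith),
        mul_div_cancel₀ _ (by positivity), mul_assoc, ← Real.mul_rpow (by norm_num) (by linarith)]
      refine (hb t h2.le).trans ?_
      gcongr
      linarith
    have h4 : |f t - f x| ≤ |f t| + |f x| := abs_sub _ _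
    rw [indicator_of_mem (mem_Ici.2 h2.le), mul_one] at hI ⊢
    linarith [hL (x - t), hR (t - x)]

/-- Integration of the pointwise estimate, for a law on `[0,∞)` with Chebyshev tails. -/
lemma IsDBV.abs_integral_sub_le {f g : ℝ → ℝ} (hf : IsDBV f g) {x M γ r : ℝ} (hx : 0 < x)
    (hM : 0 ≤ M) (hγ : 0 ≤ γ) (hr : 0 < r) (hγr : γ ≤ 2 * r)
    (hb : ∀ t, 2 * x ≤ t → |f t| ≤ M * t ^ γ) {κ : Measure ℝ} [IsProbabilityMeasure κ]
    (hκ : ∀ᵐ t ∂κ, 0 ≤ t) (hfκ : Integrable f κ) (hid : Integrable (fun t => t) κ)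
    (hψ : Integrable (truncPow x (2 * r)) κ) {D τ : ℝ} (hD : 0 ≤ D) {n : ℕ} (hn : 0 < n)
    (hright : ∀ a : ℝ, 0 < a → κ.real {t | a ≤ t - x} ≤ D / (n * a ^ 2))
    (hleft : ∀ a : ℝ, 0 < a → κ.real {t | a ≤ x - t} ≤ D / (n * a ^ 2))
    (hpos : ∫ t, max (t - x) 0 ∂κ ≤ τ) (hneg : ∫ t, max (x - t) 0 ∂κ ≤ τ) :
    |∫ t, f t ∂κ - f x| ≤ |Function.leftLim g x| * τ + |Function.rightLim g x| * τ +
      (D / (n * x) * ∑ k ∈ Finset.Icc 1 ⌊√(n : ℝ)⌋₊, leftVar g x (x / k) +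
          x / √(n : ℝ) * leftVar g x (x / √(n : ℝ))) +
      (D / (n * x) * ∑ k ∈ Finset.Icc 1 ⌊√(n : ℝ)⌋₊, rightVar g x (x / k) +
          x / √(n : ℝ) * rightVar g x (x / √(n : ℝ))) +
      M * 2 ^ γ * (∫ t, truncPow x (2 * r) t ∂κ) ^ (γ / (2 * r)) +
      |f x| * (D / (n * x ^ 2)) := by
  have hr2 : 0 < 2 * r := by positivity
  have hθ0 : 0 ≤ γ / (2 * r) := by positivity
  have hθ1 : γ / (2 * r) ≤ 1 := (div_le_one hr2).2 hγr
  have hψ0 := truncPow_nonneg hx.le (2 * r)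
  have iN : Integrable (fun t => max (x - t) 0) κ := ((integrable_const x).sub hid).pos_part
  have iP : Integrable (fun t => max (t - x) 0) κ := (hid.sub (integrable_const x)).pos_part
  obtain ⟨iL, hL⟩ := integral_primitive_le (κ := κ) (Y := fun t => x - t) (by fun_prop)
    (monotone_leftVar hf.boundedVariation (x := x)) (fun s => totalVar_nonneg _ _ _) hx hD hn
    hleft
  obtain ⟨iR, hR⟩ := integral_primitive_le (κ := κ) (Y := fun t => t - x) (by fun_prop)
    (monotone_rightVar hf.boundedVariation hx.le) (fun s => totalVar_nonneg _ _ _) hx hD hn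
    hright
  have iT : Integrable (fun t => truncPow x (2 * r) t ^ (γ / (2 * r))) κ := by
    refine ((integrable_const (1 : ℝ)).add hψ).mono'
      ((measurable_truncPow x (2 * r)).pow_const _).aestronglyMeasurable (ae_of_all _ fun t => ?_)
    rw [Real.norm_of_nonneg (Real.rpow_nonneg (hψ0 t) _)]
    simpa using rpow_le_one_add_pow (hψ0 t) hθ0 (N := 1) (by simpa using hθ1)
  have iI : Integrable ((Ici (2 * x)).indicator fun _ => (1 : ℝ)) κ :=
    (integrable_const 1).indicator measurableSet_Ici
  -- Jensen's inequality for the concave power `γ / 2r`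
  have hJ : ∫ t, truncPow x (2 * r) t ^ (γ / (2 * r)) ∂κ ≤
      (∫ t, truncPow x (2 * r) t ∂κ) ^ (γ / (2 * r)) :=
    (Real.concaveOn_rpow hθ0 hθ1).le_map_integral
      (fun s _ => (Real.continuousAt_rpow_const s _ (Or.inr hθ0)).continuousWithinAt) isClosed_Ici
      (ae_of_all _ hψ0) hψ iT
  have hI : ∫ t, (Ici (2 * x)).indicator (fun _ => (1 : ℝ)) t ∂κ ≤ D / (n * x ^ 2) := by
    rw [integral_indicator measurableSet_Ici]
    simp only [integral_const, smul_eq_mul, mul_one, measureReal_restrict_apply_univ]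
    refine le_trans (le_of_eq ?_) (hright x hx)
    congr 1
    ext t
    simp only [mem_Ici, mem_ofPred_eq]
    constructor <;> intro h <;> linarith
  have h1 : ∫ t, f t ∂κ - f x = ∫ t, (f t - f x) ∂κ := by
    rw [integral_sub hfκ (integrable_const _)]
    simp
  have iG := ((((((iN.const_mul |Function.leftLim g x|).add
    (iP.const_mul |Function.rightLim g x|)).add iL).add iR).add
    (iT.const_mul (M * 2 ^ γ))).add (iI.const_mul |f x|))
  rw [h1]
  refine abs_integral_le_integral_abs.trans ?_
  refine (integral_mono_ae (hfκ.sub (integrable_const _)).abs iG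
    (hκ.mono fun t ht => hf.abs_sub_le hx hM hγ hr hb ht)).trans ?_
  rw [integral_add' ((((((iN.const_mul |Function.leftLim g x|).add
      (iP.const_mul |Function.rightLim g x|)).add iL).add iR).add
      (iT.const_mul (M * 2 ^ γ)))) (iI.const_mul |f x|),
    integral_add' (((((iN.const_mul |Function.leftLim g x|).add
      (iP.const_mul |Function.rightLim g x|)).add iL).add iR)) (iT.const_mul (M * 2 ^ γ)),
    integral_add' ((((iN.const_mul |Function.leftLim g x|).add
      (iP.const_mul |Function.rightLim g x|)).add iL)) iR,
    integral_add' (((iN.const_mul |Function.leftLim g x|).add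
      (iP.const_mul |Function.rightLim g x|))) iL,
    integral_add' (iN.const_mul |Function.leftLim g x|) (iP.const_mul |Function.rightLim g x|),
    integral_const_mul, integral_const_mul, integral_const_mul, integral_const_mul]
  gcongr

end GuptaSrivastava

theorem theorem3 (c : ℕ) (m : ℤ) (α : ℝ) (hα : 1 ≤ α) (f g : ℝ → ℝ)
    (hf : GuptaSrivastava.IsDBV f g) :
    (∀ n : ℕ, GuptaSrivastava.bezierOp n m c α f 0 = f 0) ∧
    ∀ x : ℝ, 0 < x → ∀ M γ r : ℝ, 0 ≤ γ → 0 < r → γ ≤ 2 * r →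
      (∀ t : ℝ, 2 * x ≤ t → |f t| ≤ M * t ^ γ) →
      ∀ᶠ n : ℕ in Filter.atTop,
        GuptaSrivastava.BezierConverges n m c α f x ∧
        GuptaSrivastava.BezierConverges n m c α (GuptaSrivastava.truncPow x (2 * r)) x ∧
        |GuptaSrivastava.bezierOp n m c α f x - f x| ≤
          1 / (α + 1) * |Function.rightLim g x + α * Function.leftLim g x| *
              √(2 * α * x * (1 + c * x) / n)
          + α / (α + 1) * |Function.rightLim g x - Function.leftLim g x| *
              √(2 * α * x * (1 + c * x) / n)
          + 2 * α * (1 + c * x) / n *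
              ∑ k ∈ Finset.Icc 1 ⌊√(n : ℝ)⌋₊,
                GuptaSrivastava.totalVar (GuptaSrivastava.auxFun g x) (x - x / k) x
          + x / √(n : ℝ) *
              GuptaSrivastava.totalVar (GuptaSrivastava.auxFun g x) (x - x / √(n : ℝ)) x
          + 2 * α * (1 + c * x) / (n * x) * |f (2 * x) - f x - x * Function.rightLim g x|
          + 2 * α * (1 + c * x) / n *
              ∑ k ∈ Finset.Icc 1 ⌊√(n : ℝ)⌋₊,
                GuptaSrivastava.totalVar (GuptaSrivastava.auxFun g x) x (x + x / k)
          + x / √(n : ℝ) *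
              GuptaSrivastava.totalVar (GuptaSrivastava.auxFun g x) x (x + x / √(n : ℝ))
          + M * 2 ^ γ *
              GuptaSrivastava.bezierOp n m c α (GuptaSrivastava.truncPow x (2 * r)) x
                ^ (γ / (2 * r))
          + 2 * α * (1 + c * x) / (n * x) * |f x|
          + √(2 * α * x * (1 + c * x) / n) * |Function.rightLim g x| := by
  open GuptaSrivastava in
  refine ⟨fun n => bezierOp_zero n m c hα f, fun x hx M γ r hγ hr hγr hb => ?_⟩
  have hM : 0 ≤ M := by
    have h1 := (abs_nonneg _).trans (hb (2 * x) le_rfl)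
    have h2 : 0 < (2 * x) ^ γ := Real.rpow_pos_of_pos (by linarith) γ
    exact nonneg_of_mul_nonneg_left h1 h2
  have hr2 : 0 < 2 * r := by positivity
  set N := ⌈2 * r⌉₊ with hN
  have hrN : 2 * r ≤ N := Nat.le_ceil _
  obtain ⟨C, hC⟩ := hf.exists_growth_bound hx.le hM hγ hb (hγr.trans hrN)
  have hlim : Tendsto (fun n : ℕ => (n : ℝ)) atTop atTop := tendsto_natCast_atTop_atTop
  have hfm : AEStronglyMeasurable f (volume.restrict (Ioi 0)) :=
    (hf.continuousOn.mono Ioi_subset_Ici_self).aestronglyMeasurable measurableSet_Ioi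
  filter_upwards [eventually_tail_and_deviation m c hα hx,
    hlim.eventually_gt_atTop (-(m * c)), hlim.eventually_gt_atTop (N * c - m * c),
    hlim.eventually_gt_atTop (c - m * c), eventually_gt_atTop 0]
    with n ⟨htr, htl, hdr, hdl⟩ hn1 hn2 hn3 hn
  have h0 : 0 < (n : ℝ) + m * c := by linarith
  have hNc : N * c < (n : ℝ) + m * c := by linarith
  obtain ⟨cf, fi, fe⟩ := bezierOp_eq_integral (α := α) hα hx.le h0 hNc hfm hC
  obtain ⟨cψ, ψi, ψe⟩ := bezierOp_eq_integral (α := α) hα hx.le h0 hNc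
    (measurable_truncPow x (2 * r)).aestronglyMeasurable
    (fun t ht => abs_truncPow_le hx.le hr2.le ht hrN)
  refine ⟨cf, cψ, ?_⟩
  have hle := bezierLaw_le (c := c) h0 hx.le hα
  have := isProbabilityMeasure_bezierLaw (c := c) h0 hx.le hα
  have hid := (moment_baseLaw (c := c) 1 h0 (by push_cast; linarith) hx.le).1
  simp only [pow_one] at hid
  have hmain := hf.abs_integral_sub_le hx hM hγ hr hγr hb
    (κ := bezierLaw ((n : ℝ) + m * c) c α x) ae_nonneg_mixture
    (fi.of_measure_le_smul ENNReal.ofReal_ne_top hle)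
    (hid.of_measure_le_smul ENNReal.ofReal_ne_top hle)
    (ψi.of_measure_le_smul ENNReal.ofReal_ne_top hle)
    (D := 2 * α * (x * (1 + c * x))) (by positivity) hn htr htl hdr hdl
  rw [← fe, ← ψe] at hmain
  have hn' : (1 : ℝ) ≤ n := by exact_mod_cast hn
  have hs1 : 1 ≤ √(n : ℝ) := Real.one_le_sqrt.2 hn'
  have e1 : 2 * α * (x * (1 + c * x)) / (n * x) = 2 * α * (1 + c * x) / n := by field_simp
  have e2 : 2 * α * (x * (1 + c * x)) / (n * x ^ 2) = 2 * α * (1 + c * x) / (n * x) := by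
    field_simp
  have e3 : ∀ y : ℝ, 1 ≤ y → leftVar g x (x / y) = totalVar (auxFun g x) (x - x / y) x :=
    fun y hy => by rw [leftVar, max_eq_left (sub_nonneg.2 (div_le_self hx.le hy))]
  have e4 : ∑ k ∈ Finset.Icc 1 ⌊√(n : ℝ)⌋₊, leftVar g x (x / k) =
      ∑ k ∈ Finset.Icc 1 ⌊√(n : ℝ)⌋₊, totalVar (auxFun g x) (x - x / k) x :=
    Finset.sum_congr rfl fun k hk => e3 k (by exact_mod_cast (Finset.mem_Icc.1 hk).1)
  rw [e1, e2, e3 _ hs1, e4, ← mul_assoc (2 * α) x] at hmain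
  simp only [rightVar] at hmain
  set τ := √(2 * α * x * (1 + c * x) / n)
  have hτ : 0 ≤ τ := Real.sqrt_nonneg _
  set p := Function.rightLim g x
  set q := Function.leftLim g x
  -- `(α + 1) g(x-) = (g(x+) + α g(x-)) - (g(x+) - g(x-))`
  have hq : |q| ≤ 1 / (α + 1) * |p + α * q| + α / (α + 1) * |p - q| := by
    have h1 := abs_sub (p + α * q) (p - q)
    rw [show p + α * q - (p - q) = (α + 1) * q by ring, abs_mul,
      abs_of_nonneg (by linarith : 0 ≤ α + 1)] at h1
    have h2 : |p - q| ≤ α * |p - q| := le_mul_of_one_le_left (abs_nonneg _) hα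
    have h3 : 0 < α + 1 := by linarith
    rw [div_mul_eq_mul_div, div_mul_eq_mul_div, ← add_div, le_div_iff₀ h3]
    linarith
  have hq' := mul_le_mul_of_nonneg_right hq hτ
  have hdrop : 0 ≤ 2 * α * (1 + c * x) / (n * x) * |f (2 * x) - f x - x * p| := by
    positivity
  linarith
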